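/- **Proposition (Euler vector field).** Let $\ell,n_p\ge 0$ and $r\ge 1$ be integers and $n_z=\ell+r+n_p+1$. Points of the Hurwitz space $\mathscr H_{0,\ell+r+n_p+1}(\ell,r-1,0,\dots,0)$ ($n_p$ zeros) are represented by the rational functions $$\lambda(w)=\frac{w^{n_z}+a_{n_z-1}w^{n_z-1}+\dots+a_0}{w^r\,(w^{n_p}+b_{n_p-1}w^{n_p-1}+\dots+b_0)}$$ whose numerator and denominator are coprime and whose finite non-zero poles are $n_p$ in number, pairwise distinct and simple. Write $\Gamma_\lambda$ for the set of zeros of $d\lambda$ in $\mathbb C$ away from the poles of $\lambda$. The primary differential $\omega=-\frac{dw}{w}$ induces on this space the Frobenius structure $$\eta(X,Y)=\sum_{q\in\Gamma_\lambda}\operatorname{Res}_q\frac{X(\lambda)Y(\lambda)}{d\lambda}\,\omega^2,\qquad c(X,Y,Z)=\eta(X\circ Y,Z)=\sum_{q\in\Gamma_\lambda}\operatorname{Res}_q\frac{X(\lambda)Y(\lambda)Z(\lambda)}{d\lambda}\,\omega^2 ,$$ with canonical coordinates the critical values $u_i$ of $\lambda$ (near points at which all critical points of $\lambda$ are simple).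 Its Euler vector field is the holomorphic vector field $E$ with $E=\sum_i u_i\,\partial_{u_i}$ in canonical coordinates, for which, at these points, $\mathcal L_E\eta=(2-d)\,\eta$ and $\mathcal L_E c=(3-d)\,c$ for some constant $d$. Then $E$ exists, it is unique, and it reads as follows. 1. In the coordinates $(\varphi,\psi)$ given, where the zeros of $\lambda$ are pairwise distinct, by $\lambda(w)=\dfrac1{w^r}\dfrac{\prod_{i=1}^{n_z}(w-e^{\varphi_i})}{\prod_{\mu=1}^{n_p}(w-e^{\psi_\mu})}$: $$E=\frac1{\ell+1}\Bigl[\sum_{i=1}^{n_z}\partial_{\varphi_i}+\sum_{\mu=1}^{n_p}\partial_{\psi_\mu}\Bigr].$$ 2. In the coordinates $(a,b)$: $$E=\frac1{\ell+1}\Bigl[\sum_{i=0}^{n_z-1}(n_z-i)\,a_i\,\partial_{a_i}+\sum_{j=0}^{n_p-1}(n_p-j)\,b_j\,\partial_{b_j}\Bigr].$$ 3. In the coordinates $(\sigma,\alpha,\beta)$ given by $\lambda(w)=w^{\ell+1}+\sum_{p=0}^{\ell+r}\sigma_p\,w^{p-r}+\sum_{\mu=1}^{n_p}\dfrac{w\,\alpha_\mu}{w-e^{\beta_\mu}}$: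 $$E=\sum_{p=0}^{\ell+r}\Bigl(1+\frac{r-p}{\ell+1}\Bigr)\sigma_p\,\partial_{\sigma_p}+\frac1{\ell+1}\sum_{\mu=1}^{n_p}\partial_{\beta_\mu}+\sum_{\mu=1}^{n_p}\alpha_\mu\,\partial_{\alpha_\mu}.$$ -/

import Mathlib

open Polynomial Filter Topology

noncomputable section

namespace HurwitzEuler

/-- Coordinate space of the coefficients `(a, b)`, with `a = (a_0, …, a_{n_z - 1})`,
`n_z = ℓ + r + n_p + 1`, and `b = (b_0, …, b_{n_p - 1})`. -/
abbrev Coef (ℓ r np : ℕ) : Type := (Fin (ℓ + r + np + 1) → ℂ) × (Fin np → ℂ)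

/-- The monic polynomial `X ^ n + c_{n-1} X ^ (n-1) + … + c_0`. -/
def monicPoly {n : ℕ} (c : Fin n → ℂ) : ℂ[X] := X ^ n + ∑ i : Fin n, C (c i) * X ^ (i : ℕ)

/-- The superpotential
`λ(w) = (w^{n_z} + a_{n_z-1} w^{n_z-1} + … + a_0) / (w^r (w^{n_p} + b_{n_p-1} w^{n_p-1} + … + b_0))`. -/
def lam {ℓ r np : ℕ} (x : Coef ℓ r np) (w : ℂ) : ℂ :=
  (monicPoly x.1).eval w / (w ^ r * (monicPoly x.2).eval w)

/-- The Hurwitz space `H_{0, ℓ+r+n_p+1}(ℓ, r-1, 0, …, 0)` (for `r ≥ 1`), each class being represented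
by a superpotential in normal form: `λ` has a pole of order exactly `ℓ + 1` at infinity (automatic),
of order exactly `r` at `0`, and `n_p` further pairwise distinct poles, which are simple. -/
def hurwitzSpace (ℓ r np : ℕ) : Set (Coef ℓ r np) :=
  {x | (monicPoly x.2).Separable ∧ (monicPoly x.2).eval 0 ≠ 0 ∧
    IsCoprime (monicPoly x.1) (X * monicPoly x.2)}

/-- The set `Γ_λ` of critical points of `λ` (at finite values of `λ`). -/
def critSet {ℓ r np : ℕ} (x : Coef ℓ r np) : Set ℂ :=
  {w | w ≠ 0 ∧ (monicPoly x.2).eval w ≠ 0 ∧ deriv (lam x) w = 0}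

/-- The points of the Hurwitz space all of whose critical points are simple; near such a point
the critical values of `λ` are local (canonical) coordinates. -/
def semisimpleLocus (ℓ r np : ℕ) : Set (Coef ℓ r np) :=
  {x | x ∈ hurwitzSpace ℓ r np ∧ ∀ q ∈ critSet x, deriv (deriv (lam x)) q ≠ 0}

/-! ### The Frobenius structure given by the primary differential `ω = -dw / w` -/

/-- The density of `ω`, that is `ω = omegaDensity w dw`: it has simple poles at `0` and `∞`, with
residues `-1` and `+1`. -/
def omegaDensity (w : ℂ) : ℂ := -1 / w

/-- The residue at `q` of `f(w) dw`, for `f` with an isolated singularity at `q`: the common value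
of `(2πi)⁻¹ ∮ f` over all small circles around `q`. -/
def residue (f : ℂ → ℂ) (q : ℂ) : ℂ :=
  limUnder (𝓝[>] (0 : ℝ)) fun ε => (2 * Real.pi * Complex.I)⁻¹ * ∮ w in C(q, ε), f w

/-- `(X(λ))(w)`: the derivative of `λ` along the tangent vector `v`, at fixed `w`. -/
def lieLam {ℓ r np : ℕ} (x v : Coef ℓ r np) (w : ℂ) : ℂ := fderiv ℂ (fun y => lam y w) x v

/-- The Frobenius pairing `η(v₁, v₂) = ∑_{q ∈ Γ_λ} Res_q (v₁(λ) v₂(λ) / dλ) ω²`. -/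
def eta {ℓ r np : ℕ} (x v₁ v₂ : Coef ℓ r np) : ℂ :=
  ∑ᶠ q ∈ critSet x, residue
    (fun w => lieLam x v₁ w * lieLam x v₂ w / deriv (lam x) w * omegaDensity w ^ 2) q

/-- The three-point function
`c(v₁, v₂, v₃) = η(v₁ ∘ v₂, v₃) = ∑_{q ∈ Γ_λ} Res_q (v₁(λ) v₂(λ) v₃(λ) / dλ) ω²`. -/
def threePoint {ℓ r np : ℕ} (x v₁ v₂ v₃ : Coef ℓ r np) : ℂ :=
  ∑ᶠ q ∈ critSet x, residue
    (fun w => lieLam x v₁ w * lieLam x v₂ w * lieLam x v₃ w / deriv (lam x) w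
      * omegaDensity w ^ 2) q

/-- The components `(L_E η)(v₁, v₂)` of the Lie derivative, `v₁`, `v₂` being extended to
constant fields, so that `[E, vᵢ] = -DE(vᵢ)`. -/
def lieEta {ℓ r np : ℕ} (E : Coef ℓ r np → Coef ℓ r np) (x v₁ v₂ : Coef ℓ r np) : ℂ :=
  fderiv ℂ (fun y => eta y v₁ v₂) x (E x)
    + eta x (fderiv ℂ E x v₁) v₂ + eta x v₁ (fderiv ℂ E x v₂)

/-- The components `(L_E c)(v₁, v₂, v₃)` of the Lie derivative of the three-point function. -/
def lieThreePoint {ℓ r np : ℕ} (E : Coef ℓ r np → Coef ℓ r np) (x v₁ v₂ v₃ : Coef ℓ r np) : ℂ :=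
  fderiv ℂ (fun y => threePoint y v₁ v₂ v₃) x (E x)
    + threePoint x (fderiv ℂ E x v₁) v₂ v₃ + threePoint x v₁ (fderiv ℂ E x v₂) v₃
    + threePoint x v₁ v₂ (fderiv ℂ E x v₃)

/-- `q` is a holomorphic branch, near `x`, of the critical points of the superpotential. The
corresponding critical value `y ↦ λ_y(q(y))` is a canonical coordinate near `x`. -/
def IsCritBranch {ℓ r np : ℕ} (x : Coef ℓ r np) (q : Coef ℓ r np → ℂ) : Prop :=
  AnalyticAt ℂ q x ∧ ∀ᶠ y in 𝓝 x, q y ∈ critSet y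

/-- `E` is the Euler vector field of the Hurwitz Frobenius manifold: it is holomorphic; it equals
`∑ u_i ∂_{u_i}` in the canonical coordinates `u_i`, i.e. `E(u_i) = u_i`; and the Frobenius structure
is homogeneous with respect to it: for some constant `d` (the charge), `L_E η = (2 - d) η` and
`L_E c = (3 - d) c` (equivalently `L_E η = (2 - d) η` and `L_E ∘ = ∘`). -/
structure IsEulerField (ℓ r np : ℕ) (E : Coef ℓ r np → Coef ℓ r np) : Prop where
  holomorphic : DifferentiableOn ℂ E (hurwitzSpace ℓ r np)
  canonical : ∀ x ∈ semisimpleLocus ℓ r np, ∀ q, IsCritBranch x q →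
    fderiv ℂ (fun y => lam y (q y)) x (E x) = lam x (q x)
  homogeneous : ∃ d : ℂ, ∀ x ∈ semisimpleLocus ℓ r np,
    (∀ v₁ v₂, lieEta E x v₁ v₂ = (2 - d) * eta x v₁ v₂) ∧
    (∀ v₁ v₂ v₃, lieThreePoint E x v₁ v₂ v₃ = (3 - d) * threePoint x v₁ v₂ v₃)

/-! ### The three coordinate systems

The `(a, b)` coordinates are those of `Coef`; the other two are given by their maps to `(a, b)`. -/

/-- Coefficients `c_0, …, c_{n-1}` of a polynomial. -/
def lowCoeffs (n : ℕ) (P : ℂ[X]) : Fin n → ℂ := fun i => P.coeff i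

/-- The monic polynomial with roots `exp z_j`. -/
def expRootsPoly {n : ℕ} (z : Fin n → ℂ) : ℂ[X] := ∏ j, (X - C (Complex.exp (z j)))

/-- The point with zeros `exp φ_i` and non-zero finite poles `exp ψ_μ`. -/
def phiPsiChart (ℓ r np : ℕ) (z : (Fin (ℓ + r + np + 1) → ℂ) × (Fin np → ℂ)) : Coef ℓ r np :=
  (lowCoeffs _ (expRootsPoly z.1), lowCoeffs _ (expRootsPoly z.2))

/-- Domain of the `(φ, ψ)` coordinates: away from the diagonals where two zeros coincide. -/
def phiPsiDomain (ℓ r np : ℕ) : Set ((Fin (ℓ + r + np + 1) → ℂ) × (Fin np → ℂ)) :=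
  {z | phiPsiChart ℓ r np z ∈ hurwitzSpace ℓ r np ∧ Function.Injective fun i => Complex.exp (z.1 i)}

/-- The space of the coordinates `(σ, α, β)`, with `σ = (σ_0, …, σ_{ℓ+r})`. -/
abbrev Flat (ℓ r np : ℕ) : Type := (Fin (ℓ + r + 1) → ℂ) × (Fin np → ℂ) × (Fin np → ℂ)

/-- The numerator of `λ` over the common denominator `w^r ∏_μ (w - exp β_μ)`. -/
def flatNum {ℓ r np : ℕ} (s : Flat ℓ r np) : ℂ[X] :=
  monicPoly s.1 * expRootsPoly s.2.2 + ∑ μ : Fin np, C (s.2.1 μ) * X ^ (r + 1) *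
    ∏ ν ∈ Finset.univ.erase μ, (X - C (Complex.exp (s.2.2 ν)))

/-- The point whose superpotential is
`w^{ℓ+1} + ∑_{p=0}^{ℓ+r} σ_p w^{p-r} + ∑_μ w α_μ / (w - exp β_μ)` (see `lam_flatChart`). -/
def flatChart (ℓ r np : ℕ) (s : Flat ℓ r np) : Coef ℓ r np :=
  (lowCoeffs _ (flatNum s), lowCoeffs _ (expRootsPoly s.2.2))

/-- Domain of the `(σ, α, β)` coordinates. -/
def flatDomain (ℓ r np : ℕ) : Set (Flat ℓ r np) := {s | flatChart ℓ r np s ∈ hurwitzSpace ℓ r np}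

/-! ### The charts give the expected superpotentials -/

theorem monicPoly_lowCoeffs {n : ℕ} {P : ℂ[X]} (hP : P.Monic) (hn : P.natDegree = n) :
    monicPoly (lowCoeffs n P) = P := by
  subst hn
  conv_rhs => rw [hP.as_sum]
  rw [monicPoly, ← Fin.sum_univ_eq_sum_range (fun i => C (P.coeff i) * X ^ i)]
  rfl

theorem expRootsPoly_monic {n : ℕ} (z : Fin n → ℂ) : (expRootsPoly z).Monic :=
  monic_prod_of_monic _ _ fun _ _ => monic_X_sub_C _

theorem expRootsPoly_natDegree {n : ℕ} (z : Fin n → ℂ) : (expRootsPoly z).natDegree = n := by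
  simp [expRootsPoly, natDegree_prod_of_monic _ _ fun i _ => monic_X_sub_C (Complex.exp (z i))]

theorem lam_phiPsiChart {ℓ r np : ℕ} (z : (Fin (ℓ + r + np + 1) → ℂ) × (Fin np → ℂ)) (w : ℂ) :
    lam (phiPsiChart ℓ r np z) w =
      1 / w ^ r * ((∏ i, (w - Complex.exp (z.1 i))) / ∏ μ, (w - Complex.exp (z.2 μ))) := by
  have h1 := monicPoly_lowCoeffs (expRootsPoly_monic z.1) (expRootsPoly_natDegree z.1)
  have h2 := monicPoly_lowCoeffs (expRootsPoly_monic z.2) (expRootsPoly_natDegree z.2)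
  simp only [lam, phiPsiChart, h1, h2]
  simp only [expRootsPoly, eval_prod, eval_sub, eval_X, eval_C]
  rw [div_mul_div_comm, one_mul]

theorem monicPoly_monic {n : ℕ} (c : Fin n → ℂ) :
    (monicPoly c).Monic ∧ (monicPoly c).natDegree = n := by
  have hd : (∑ i : Fin n, C (c i) * X ^ (i : ℕ)).degree < (n : WithBot ℕ) := by
    refine (degree_sum_le _ _).trans_lt ((Finset.sup_lt_iff (WithBot.bot_lt_coe n)).2 fun i _ => ?_)
    exact (degree_C_mul_X_pow_le _ _).trans_lt (WithBot.coe_lt_coe.2 i.2)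
  refine ⟨monic_X_pow_add hd, ?_⟩
  rw [monicPoly, natDegree_add_eq_left_of_degree_lt (by simpa using hd), natDegree_X_pow]

theorem flatNum_monic {ℓ r np : ℕ} (s : Flat ℓ r np) :
    (flatNum s).Monic ∧ (flatNum s).natDegree = ℓ + r + np + 1 := by
  obtain ⟨m1, d1⟩ := monicPoly_monic s.1
  have m2 := expRootsPoly_monic s.2.2
  have d2 := expRootsPoly_natDegree s.2.2
  have d12 : (monicPoly s.1 * expRootsPoly s.2.2).natDegree = ℓ + r + np + 1 := by
    rw [m1.natDegree_mul m2, d1, d2]; omega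
  have hlt : (∑ μ : Fin np, C (s.2.1 μ) * X ^ (r + 1) *
      ∏ ν ∈ Finset.univ.erase μ, (X - C (Complex.exp (s.2.2 ν)))).degree <
      (monicPoly s.1 * expRootsPoly s.2.2).degree := by
    rw [degree_eq_natDegree (m1.mul m2).ne_zero, d12]
    refine (degree_sum_le _ _).trans_lt ((Finset.sup_lt_iff (WithBot.bot_lt_coe _)).2 fun i _ => ?_)
    refine (degree_mul_le _ _).trans_lt ?_
    have e1 : (∏ ν ∈ Finset.univ.erase i, (X - C (Complex.exp (s.2.2 ν)))).degree
        = ((np - 1 : ℕ) : WithBot ℕ) := by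
      simp [degree_prod, degree_X_sub_C, Finset.card_erase_of_mem]
    rw [e1]
    refine (add_le_add_left (degree_C_mul_X_pow_le (r + 1) (s.2.1 i)) _).trans_lt ?_
    have := i.2
    exact_mod_cast (by omega : r + 1 + (np - 1) < ℓ + r + np + 1)
  exact ⟨(m1.mul m2).add_of_left hlt, by
    rw [flatNum, natDegree_add_eq_left_of_degree_lt hlt, d12]⟩

theorem lam_flatChart {ℓ r np : ℕ} (s : Flat ℓ r np) {w : ℂ} (hw : w ≠ 0)
    (hβ : ∀ μ, w ≠ Complex.exp (s.2.2 μ)) :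
    lam (flatChart ℓ r np s) w =
      w ^ (ℓ + 1) + ∑ p : Fin (ℓ + r + 1), s.1 p * w ^ (((p : ℕ) : ℤ) - (r : ℤ))
        + ∑ μ, w * s.2.1 μ / (w - Complex.exp (s.2.2 μ)) := by
  have h1 := monicPoly_lowCoeffs (flatNum_monic s).1 (flatNum_monic s).2
  have h2 := monicPoly_lowCoeffs (expRootsPoly_monic s.2.2) (expRootsPoly_natDegree s.2.2)
  have hne : ∀ μ, w - Complex.exp (s.2.2 μ) ≠ 0 := fun μ => sub_ne_zero.2 (hβ μ)
  have hP : (∏ μ, (w - Complex.exp (s.2.2 μ))) ≠ 0 := Finset.prod_ne_zero_iff.2 fun μ _ => hne μ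
  have hr : w ^ r ≠ 0 := pow_ne_zero _ hw
  simp only [lam, flatChart, h1, h2]
  simp only [flatNum, monicPoly, expRootsPoly, eval_prod, eval_sub, eval_X, eval_C, eval_add,
    eval_mul, eval_pow, eval_finsetSum]
  rw [add_div, mul_div_mul_right _ _ hP, add_div, Finset.sum_div, Finset.sum_div]
  congr 1
  · congr 1
    · rw [div_eq_iff hr]; ring
    · refine Finset.sum_congr rfl fun p _ => ?_
      rw [zpow_sub₀ hw, zpow_natCast, zpow_natCast, mul_div_assoc]
  · refine Finset.sum_congr rfl fun μ _ => ?_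
    rw [← Finset.mul_prod_erase Finset.univ _ (Finset.mem_univ μ)]
    have hE : (∏ ν ∈ Finset.univ.erase μ, (w - Complex.exp (s.2.2 ν))) ≠ 0 :=
      Finset.prod_ne_zero_iff.2 fun ν _ => hne ν
    have := hne μ
    field_simp
    ring

end HurwitzEuler

end

/-! The field is the generator of the dilation `w ↦ t w`. Multiplying all zeros and poles by `t`
gives a superpotential with `λ_{tx}(t w) = t^(ℓ+1) λ_x(w)`, because the weight `n_z` of the
numerator exceeds that of the denominator by `ℓ + 1`. Infinitesimally, `E(λ) = λ - w λ' / (ℓ + 1)`,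
where `E` is the generator divided by `ℓ + 1` (`lieLam_eulerField`). At a critical point the last
term vanishes, so `E(u_i) = u_i`.

Homogeneity comes from the same action. Since `ω` is dilation invariant, the form with `k + 1`
arguments has weight `k` in units of `t^(ℓ+1)` (`critTerm_scale`). Differentiating at `t = 1`
(`lie_resForm`) gives factors `1` for `η` and `2` for `c`, hence `d = 1`.

For uniqueness, the numerator of `v(λ)` has degree less than `n_z + n_p`, the number of critical
points at a semisimple point. If `v` kills all critical values, this numerator is zero, and
coprimality gives `v = 0` (`eq_zero_of_lieLam_eq_zero`). So `E(u_i) = u_i` determines `E` on the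
semisimple locus, and by continuity everywhere: `λ + t / w` is semisimple for all small `t ≠ 0`
(`eventually_addPole_mem`).

In the two other charts the dilation is explicit: it shifts `φ`, `ψ`, `β` by `log t` and rescales
`σ`, `α`. Both charts have injective differential, so the velocity of this flow, divided by `ℓ + 1`,
is the only vector mapped to `E`. -/

noncomputable section

namespace HurwitzEuler

open scoped ContDiff

variable {ℓ r np : ℕ}

/-! ### Polynomials with prescribed low coefficients -/

/-- The polynomial `c_{n-1} X ^ (n-1) + … + c_0`. -/
def lowPoly {n : ℕ} (c : Fin n → ℂ) : ℂ[X] := ∑ i : Fin n, C (c i) * X ^ (i : ℕ)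

theorem monicPoly_eq {n : ℕ} (c : Fin n → ℂ) : monicPoly c = X ^ n + lowPoly c := rfl

theorem lowPoly_degree_lt {n : ℕ} (c : Fin n → ℂ) : (lowPoly c).degree < (n : WithBot ℕ) := by
  refine (degree_sum_le _ _).trans_lt ((Finset.sup_lt_iff (WithBot.bot_lt_coe n)).2 fun i _ => ?_)
  exact (degree_C_mul_X_pow_le _ _).trans_lt (WithBot.coe_lt_coe.2 i.2)

theorem lowPoly_coeff {n : ℕ} (c : Fin n → ℂ) (i : Fin n) : (lowPoly c).coeff i = c i := by
  simp only [lowPoly, finsetSum_coeff, coeff_C_mul_X_pow]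
  rw [Finset.sum_eq_single i] <;> simp +contextual [Fin.ext_iff, eq_comm]

theorem lowPoly_injective {n : ℕ} : Function.Injective (lowPoly : (Fin n → ℂ) → ℂ[X]) :=
  fun c d h => funext fun i => by rw [← lowPoly_coeff c i, h, lowPoly_coeff]

@[simp] theorem lowPoly_zero {n : ℕ} : lowPoly (0 : Fin n → ℂ) = 0 := by simp [lowPoly]

theorem eval_lowPoly {n : ℕ} (c : Fin n → ℂ) (w : ℂ) :
    (lowPoly c).eval w = ∑ i : Fin n, c i * w ^ (i : ℕ) := by
  simp [lowPoly, eval_finsetSum]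

theorem eval_monicPoly {n : ℕ} (c : Fin n → ℂ) (w : ℂ) :
    (monicPoly c).eval w = w ^ n + (lowPoly c).eval w := by simp [monicPoly_eq]

/-- Evaluation at `w` of the polynomial with the given low coefficients, as a linear form. -/
def evalLow (n : ℕ) (w : ℂ) : (Fin n → ℂ) →L[ℂ] ℂ :=
  ∑ i : Fin n, w ^ (i : ℕ) • ContinuousLinearMap.proj i

theorem evalLow_apply {n : ℕ} (w : ℂ) (c : Fin n → ℂ) : evalLow n w c = (lowPoly c).eval w := by
  simp [evalLow, eval_lowPoly, mul_comm]

theorem hasFDerivAt_eval_monicPoly {n : ℕ} (w : ℂ) (c : Fin n → ℂ) :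
    HasFDerivAt (fun c : Fin n → ℂ => (monicPoly c).eval w) (evalLow n w) c := by
  simp only [eval_monicPoly, ← evalLow_apply]
  exact (evalLow n w).hasFDerivAt.const_add _

/-- Joint regularity in coefficients and point: it feeds the implicit function theorem for critical
points and the differentiation of residues along them. -/
theorem contDiff_eval_iterate_derivative (n k : ℕ) :
    ContDiff ℂ ω fun p : (Fin n → ℂ) × ℂ => (derivative^[k] (monicPoly p.1)).eval p.2 := by
  have h : (fun p : (Fin n → ℂ) × ℂ => (derivative^[k] (monicPoly p.1)).eval p.2) =
      fun p => (derivative^[k] (X ^ n : ℂ[X])).eval p.2 +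
        ∑ i : Fin n, p.1 i * (derivative^[k] (X ^ (i : ℕ) : ℂ[X])).eval p.2 := by
    funext p
    simp [monicPoly, iterate_map_add, iterate_derivative_sum, iterate_derivative_C_mul,
      eval_finsetSum]
  have hp : ∀ P : ℂ[X], ContDiff ℂ ω fun p : (Fin n → ℂ) × ℂ => P.eval p.2 := fun P => by
    simp only [← coe_aeval_eq_eval]
    exact (P.contDiff_aeval (𝕜 := ℂ) ω).comp contDiff_snd
  rw [h]
  refine (hp _).add (ContDiff.sum fun i _ => ContDiff.mul ?_ (hp _))
  fun_prop

/-! ### The weighted scaling -/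

/-- The scaling of the coefficients of a monic polynomial of degree `n` which multiplies its roots
by `t`. -/
def wscale {n : ℕ} (t : ℂ) (c : Fin n → ℂ) : Fin n → ℂ := fun i => t ^ (n - (i : ℕ)) * c i

/-- The infinitesimal generator of `wscale`. -/
def wgen {n : ℕ} (c : Fin n → ℂ) : Fin n → ℂ := fun i => ((n : ℂ) - ((i : ℕ) : ℂ)) * c i

theorem eval_lowPoly_wscale {n : ℕ} (t w : ℂ) (c : Fin n → ℂ) :
    (lowPoly (wscale t c)).eval (t * w) = t ^ n * (lowPoly c).eval w := by
  simp only [eval_lowPoly, Finset.mul_sum, wscale]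
  refine Finset.sum_congr rfl fun i _ => ?_
  have : t ^ n = t ^ (n - (i : ℕ)) * t ^ (i : ℕ) := by rw [← pow_add, Nat.sub_add_cancel i.2.le]
  rw [this, mul_pow]; ring

theorem eval_monicPoly_wscale {n : ℕ} (t w : ℂ) (c : Fin n → ℂ) :
    (monicPoly (wscale t c)).eval (t * w) = t ^ n * (monicPoly c).eval w := by
  rw [eval_monicPoly, eval_monicPoly, eval_lowPoly_wscale, mul_pow]; ring

theorem hasDerivAt_wscale {n : ℕ} (c : Fin n → ℂ) :
    HasDerivAt (fun t : ℂ => wscale t c) (wgen c) 1 := by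
  rw [hasDerivAt_pi]
  intro i
  have := ((hasDerivAt_pow (n - (i : ℕ)) (1 : ℂ)).mul_const (c i))
  simpa [wscale, wgen, Nat.cast_sub i.2.le] using this

/-- `X d/dX` multiplies `X^i` by `i = n - (n - i)`, and the weight `n - i` vanishes on the leading
term, so the defect has low degree. -/
theorem X_mul_derivative_monicPoly {n : ℕ} (c : Fin n → ℂ) :
    X * derivative (monicPoly c) = (n : ℂ[X]) * monicPoly c - lowPoly (wgen c) := by
  have hX : ∀ m : ℕ, (X : ℂ[X]) * ((m : ℂ[X]) * X ^ (m - 1)) = (m : ℂ[X]) * X ^ m := by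
    rintro (_ | m)
    · simp
    · rw [Nat.add_sub_cancel, pow_succ]; ring
  have h : X * derivative (lowPoly c) = (n : ℂ[X]) * lowPoly c - lowPoly (wgen c) := by
    simp only [lowPoly, derivative_sum, derivative_C_mul_X_pow, Finset.mul_sum, wgen,
      ← Finset.sum_sub_distrib]
    refine Finset.sum_congr rfl fun i _ => ?_
    have := hX i
    simp only [C_mul, C_sub, map_natCast] at this ⊢
    linear_combination C (c i) * this
  rw [monicPoly_eq, derivative_add, mul_add, h, derivative_X_pow, map_natCast, hX]
  ring

/-! ### The superpotential and its critical points -/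

/-- The finite, non-zero points at which the superpotential is regular. -/
def regSet (x : Coef ℓ r np) : Set ℂ := {w | w ≠ 0 ∧ (monicPoly x.2).eval w ≠ 0}

theorem isOpen_regSet (x : Coef ℓ r np) : IsOpen (regSet x) :=
  isOpen_ne.inter (isOpen_ne_fun (monicPoly x.2).continuous continuous_const)

theorem critSet_subset_regSet (x : Coef ℓ r np) : critSet x ⊆ regSet x := fun _ h => ⟨h.1, h.2.1⟩

/-- The numerator of the derivative of the superpotential. -/
def critPoly (x : Coef ℓ r np) : ℂ[X] :=
  X * (derivative (monicPoly x.1) * monicPoly x.2 - monicPoly x.1 * derivative (monicPoly x.2))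
    - (r : ℂ[X]) * monicPoly x.1 * monicPoly x.2

theorem hasDerivAt_lam {x : Coef ℓ r np} {w : ℂ} (hw : w ∈ regSet x) :
    HasDerivAt (lam x) ((critPoly x).eval w / (w ^ (r + 1) * (monicPoly x.2).eval w ^ 2)) w := by
  obtain ⟨h0, hQ⟩ := hw
  have h := ((monicPoly x.1).hasDerivAt w).div
    ((hasDerivAt_pow r w).mul ((monicPoly x.2).hasDerivAt w)) (mul_ne_zero (pow_ne_zero r h0) hQ)
  refine h.congr_deriv ?_
  -- For `r = 0` the truncated exponent is harmless, since both sides vanish.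
  have hr : (r : ℂ) * w ^ (r - 1) = r * w ^ r / w := by
    rcases r with _ | r
    · simp
    · rw [Nat.add_sub_cancel, pow_succ]; field_simp
  simp only [critPoly, eval_sub, eval_mul, eval_X, eval_natCast, Pi.mul_apply]
  rw [hr]
  field_simp
  ring

theorem deriv_lam {x : Coef ℓ r np} {w : ℂ} (hw : w ∈ regSet x) :
    deriv (lam x) w = (critPoly x).eval w / (w ^ (r + 1) * (monicPoly x.2).eval w ^ 2) :=
  (hasDerivAt_lam hw).deriv

theorem mem_critSet_iff {x : Coef ℓ r np} {w : ℂ} :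
    w ∈ critSet x ↔ w ∈ regSet x ∧ (critPoly x).IsRoot w := by
  refine ⟨fun h => ⟨critSet_subset_regSet x h, ?_⟩, fun h => ⟨h.1.1, h.1.2, ?_⟩⟩
  · have h1 := h.2.2
    rw [deriv_lam (critSet_subset_regSet x h)] at h1
    exact (div_eq_zero_iff.1 h1).resolve_right
      (mul_ne_zero (pow_ne_zero _ h.1) (pow_ne_zero _ h.2.1))
  · rw [deriv_lam h.1, h.2.eq_zero, zero_div]

/-- The numerator of `λ'` vanishes at `q`, so only its derivative survives; simple critical points
are thus simple roots of `critPoly`. -/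
theorem deriv_deriv_lam {x : Coef ℓ r np} {q : ℂ} (hq : q ∈ critSet x) :
    deriv (deriv (lam x)) q =
      (derivative (critPoly x)).eval q / (q ^ (r + 1) * (monicPoly x.2).eval q ^ 2) := by
  obtain ⟨hreg, hroot⟩ := mem_critSet_iff.1 hq
  have hev : deriv (lam x) =ᶠ[𝓝 q] fun w =>
      (critPoly x).eval w / (w ^ (r + 1) * (monicPoly x.2).eval w ^ 2) :=
    ((isOpen_regSet x).eventually_mem hreg).mono fun _ hw => deriv_lam hw
  have hne : q ^ (r + 1) * (monicPoly x.2).eval q ^ 2 ≠ 0 :=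
    mul_ne_zero (pow_ne_zero _ hreg.1) (pow_ne_zero _ hreg.2)
  rw [hev.deriv_eq]
  have h := ((critPoly x).hasDerivAt q).div
    ((hasDerivAt_pow (r + 1) q).mul (((monicPoly x.2).hasDerivAt q).pow 2)) hne
  refine (h.congr_deriv ?_).deriv
  rw [show eval q (critPoly x) = 0 from hroot, zero_mul, sub_zero]
  simp only [Pi.mul_apply, Pi.pow_apply]
  field_simp

theorem analyticAt_lam {x : Coef ℓ r np} {w : ℂ} (hw : w ∈ regSet x) : AnalyticAt ℂ (lam x) w :=
  DifferentiableOn.analyticAt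
    (fun _ hu => (hasDerivAt_lam hu).differentiableAt.differentiableWithinAt)
    ((isOpen_regSet x).mem_nhds hw)

/-- The factor is `n_z - n_p - r = ℓ + 1`; the subtracted term is the numerator of the derivative of
`λ` along the dilation. This yields both the leading term of `critPoly` and the formula for `E(λ)`.
-/
theorem critPoly_eq (x : Coef ℓ r np) :
    critPoly x = C ((ℓ : ℂ) + 1) * (monicPoly x.1 * monicPoly x.2) -
      (lowPoly (wgen x.1) * monicPoly x.2 - monicPoly x.1 * lowPoly (wgen x.2)) := by
  have h1 := X_mul_derivative_monicPoly x.1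
  have h2 := X_mul_derivative_monicPoly x.2
  rw [critPoly]
  push_cast at h1
  simp only [map_add, map_natCast, map_one]
  linear_combination monicPoly x.2 * h1 - monicPoly x.1 * h2

/-- Variations of monic polynomials lose a degree. This strict bound is what makes `n_z + n_p`
critical points enough to detect a tangent vector. -/
theorem degree_lieNum_lt (x v : Coef ℓ r np) :
    (lowPoly v.1 * monicPoly x.2 - monicPoly x.1 * lowPoly v.2).degree <
      ((ℓ + r + np + 1 + np : ℕ) : WithBot ℕ) := by
  obtain ⟨m1, d1⟩ := monicPoly_monic x.1
  obtain ⟨m2, d2⟩ := monicPoly_monic x.2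
  refine (degree_sub_le _ _).trans_lt (max_lt ?_ ?_)
  · rw [degree_mul, degree_eq_natDegree m2.ne_zero, d2, Nat.cast_add]
    exact WithBot.add_lt_add_right (by simp) (lowPoly_degree_lt v.1)
  · rw [degree_mul, degree_eq_natDegree m1.ne_zero, d1, Nat.cast_add]
    exact WithBot.add_lt_add_left (by simp) (lowPoly_degree_lt v.2)

theorem natDegree_critPoly (x : Coef ℓ r np) :
    critPoly x ≠ 0 ∧ (critPoly x).natDegree = ℓ + r + np + 1 + np := by
  obtain ⟨m1, d1⟩ := monicPoly_monic x.1
  obtain ⟨m2, d2⟩ := monicPoly_monic x.2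
  have hl : (C ((ℓ : ℂ) + 1) * (monicPoly x.1 * monicPoly x.2)).degree =
      ((ℓ + r + np + 1 + np : ℕ) : WithBot ℕ) := by
    rw [degree_C_mul (Nat.cast_add_one_ne_zero ℓ), degree_eq_natDegree (m1.mul m2).ne_zero,
      m1.natDegree_mul m2, d1, d2]
  have hd : (critPoly x).degree = ((ℓ + r + np + 1 + np : ℕ) : WithBot ℕ) := by
    rw [critPoly_eq, degree_sub_eq_left_of_degree_lt, hl]
    exact (degree_lieNum_lt x (wgen x.1, wgen x.2)).trans_eq hl.symm
  exact ⟨fun h => by rw [h, degree_zero] at hd; exact WithBot.bot_ne_natCast _ hd, natDegree_eq_of_degree_eq_some hd⟩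

/-- Away from the poles, the derivative of `λ` along a tangent vector. -/
theorem hasFDerivAt_lam {x : Coef ℓ r np} {w : ℂ} (hw : w ∈ regSet x) :
    ∃ L : Coef ℓ r np →L[ℂ] ℂ, HasFDerivAt (fun y : Coef ℓ r np => lam y w) L x ∧ ∀ v, L v =
      (lowPoly v.1 * monicPoly x.2 - monicPoly x.1 * lowPoly v.2).eval w /
        (w ^ r * (monicPoly x.2).eval w ^ 2) := by
  have h1 := (hasFDerivAt_eval_monicPoly w x.1).comp x (hasFDerivAt_fst (𝕜 := ℂ))
  have h2 := (hasFDerivAt_eval_monicPoly w x.2).comp x (hasFDerivAt_snd (𝕜 := ℂ))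
  have h3 := (hasDerivAt_inv (mul_ne_zero (pow_ne_zero r hw.1) hw.2)).comp_hasFDerivAt x
    (h2.const_mul (w ^ r))
  refine ⟨_, h1.mul h3, fun v => ?_⟩
  have hw1 := hw.1
  have hw2 := hw.2
  simp [evalLow_apply]
  field_simp
  ring

theorem lieLam_eq {x : Coef ℓ r np} {w : ℂ} (hw : w ∈ regSet x) (v : Coef ℓ r np) :
    lieLam x v w = (lowPoly v.1 * monicPoly x.2 - monicPoly x.1 * lowPoly v.2).eval w /
      (w ^ r * (monicPoly x.2).eval w ^ 2) := by
  obtain ⟨L, h, hL⟩ := hasFDerivAt_lam hw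
  rw [lieLam, h.fderiv, hL]

theorem analyticAt_lieLam {x : Coef ℓ r np} {w : ℂ} (hw : w ∈ regSet x) (v : Coef ℓ r np) :
    AnalyticAt ℂ (lieLam x v) w := by
  have hne : w ^ r * (monicPoly x.2).eval w ^ 2 ≠ 0 :=
    mul_ne_zero (pow_ne_zero _ hw.1) (pow_ne_zero _ hw.2)
  have hp : ∀ P : ℂ[X], AnalyticAt ℂ (fun u => P.eval u) w := fun P => by
    simpa using P.differentiable.analyticAt w
  refine AnalyticAt.congr (f := fun w =>
    (lowPoly v.1 * monicPoly x.2 - monicPoly x.1 * lowPoly v.2).eval w /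
        (w ^ r * (monicPoly x.2).eval w ^ 2)) ?_ ?_
  · exact (hp _).div ((analyticAt_id.pow r).mul ((hp _).pow 2)) hne
  · exact ((isOpen_regSet x).eventually_mem hw).mono fun u hu => (lieLam_eq hu v).symm

/-! ### Residues at simple zeros -/

/-- By Cauchy's formula the normalised integral equals `g q` on every small circle, so the limit is
that of an eventually constant function. -/
theorem residue_of_simple_pole {f g : ℂ → ℂ} {q : ℂ} (hg : AnalyticAt ℂ g q)
    (hf : ∀ᶠ w in 𝓝[≠] q, f w = (w - q)⁻¹ * g w) : residue f q = g q := by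
  refine Tendsto.limUnder_eq (tendsto_const_nhds.congr' ?_)
  obtain ⟨δ, hδ, hball⟩ := Metric.eventually_nhds_iff_ball.1
    (hg.eventually_analyticAt.and (eventually_nhdsWithin_iff.1 hf))
  filter_upwards [Ioo_mem_nhdsGT hδ] with ε hε
  have hsub : Metric.closedBall q ε ⊆ Metric.ball q δ := Metric.closedBall_subset_ball hε.2
  have hcongr : (∮ w in C(q, ε), f w) = ∮ w in C(q, ε), (w - q)⁻¹ • g w := by
    refine circleIntegral.integral_congr hε.1.le fun w hw => ?_
    refine (hball w (hsub (Metric.sphere_subset_closedBall hw))).2 ?_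
    rintro rfl
    simp [hε.1.ne] at hw
  have hd : DifferentiableOn ℂ g (Metric.closedBall q ε) := fun w hw =>
    (hball w (hsub hw)).1.differentiableAt.differentiableWithinAt
  have hc := hd.circleIntegral_sub_inv_smul (Metric.mem_ball_self hε.1)
  rw [hcongr, hc, smul_eq_mul, inv_mul_cancel_left₀ Complex.two_pi_I_ne_zero]

theorem residue_div_of_simple_zero {g h : ℂ → ℂ} {q : ℂ} (hg : AnalyticAt ℂ g q)
    (hh : AnalyticAt ℂ h q) (h0 : h q = 0) (h1 : deriv h q ≠ 0) :
    residue (fun w => g w / h w) q = g q / deriv h q := by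
  -- Write `h = (w - q) * dslope h q`; the second factor is analytic by removable singularities and
  -- equals `h'(q)` at `q`.
  have hds : AnalyticAt ℂ (dslope h q) q := by
    obtain ⟨s, hs, hd⟩ := hh.eventually_analyticAt.exists_mem
    have : DifferentiableOn ℂ (dslope h q) s :=
      (Complex.differentiableOn_dslope hs).2 fun w hw =>
        (hd w hw).differentiableAt.differentiableWithinAt
    exact this.analyticAt hs
  have key := residue_of_simple_pole (f := fun w => g w / h w)
    (hg.div hds (by rwa [dslope_same])) ?_
  · simpa [dslope_same] using key
  · filter_upwards [self_mem_nhdsWithin] with w hw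
    have hw' : w - q ≠ 0 := sub_ne_zero.2 hw
    simp only [Pi.div_apply]
    rw [dslope_of_ne _ hw, slope_def_field, h0, sub_zero]
    field_simp

/-! ### The multilinear forms `∑ Res (∏ vⱼ(λ) / dλ) ω²` -/

/-- The form `(v_j) ↦ ∑_{q ∈ Γ_λ} Res_q (∏_j v_j(λ) / dλ) ω²`. -/
def resForm {k : ℕ} (x : Coef ℓ r np) (v : Fin k → Coef ℓ r np) : ℂ :=
  ∑ᶠ q ∈ critSet x, residue
    (fun w => (∏ j, lieLam x (v j) w) / deriv (lam x) w * omegaDensity w ^ 2) q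

theorem eta_eq_resForm (x v₁ v₂ : Coef ℓ r np) : eta x v₁ v₂ = resForm x ![v₁, v₂] := by
  simp [eta, resForm, Fin.prod_univ_two]

theorem threePoint_eq_resForm (x v₁ v₂ v₃ : Coef ℓ r np) :
    threePoint x v₁ v₂ v₃ = resForm x ![v₁, v₂, v₃] := by
  simp [threePoint, resForm, Fin.prod_univ_three]

/-- The contribution of a simple critical point to `resForm`. -/
def critTerm {k : ℕ} (x : Coef ℓ r np) (v : Fin k → Coef ℓ r np) (q : ℂ) : ℂ :=
  (∏ j, lieLam x (v j) q) * omegaDensity q ^ 2 / deriv (deriv (lam x)) q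

theorem resForm_eq {k : ℕ} {x : Coef ℓ r np} (hx : ∀ q ∈ critSet x, deriv (deriv (lam x)) q ≠ 0)
    (v : Fin k → Coef ℓ r np) : resForm x v = ∑ᶠ q ∈ critSet x, critTerm x v q := by
  refine finsum_mem_congr rfl fun q hq => ?_
  have hreg := critSet_subset_regSet x hq
  have hG : AnalyticAt ℂ (fun w => (∏ j, lieLam x (v j) w) * omegaDensity w ^ 2) q := by
    refine (Finset.analyticAt_fun_prod _ fun j _ => analyticAt_lieLam hreg (v j)).mul ?_
    exact (analyticAt_const.div analyticAt_id hreg.1).pow 2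
  rw [critTerm, ← residue_div_of_simple_zero hG (analyticAt_lam hreg).deriv hq.2.2 (hx q hq)]
  congr 1
  funext w
  ring

/-! ### Critical points on the semisimple locus -/

/-- With `P / (w^r Q)` for `λ`, no root of `critPoly` is a pole: its value is `-r P(0) Q(0)` at `0`,
nonzero since `r ≥ 1`, and `-w P(w) Q'(w)` at a root of `Q`, nonzero since these poles are simple.
-/
theorem critSet_eq_roots (hr : 1 ≤ r) {x : Coef ℓ r np} (hx : x ∈ hurwitzSpace ℓ r np) :
    critSet x = ((critPoly x).roots.toFinset : Set ℂ) := by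
  obtain ⟨hsep, hQ0, hcop⟩ := hx
  ext w
  rw [mem_critSet_iff, Finset.mem_coe, Multiset.mem_toFinset,
    mem_roots (natDegree_critPoly x).1, and_iff_right_iff_imp]
  intro hw
  have hw' : w * ((derivative (monicPoly x.1)).eval w * (monicPoly x.2).eval w
      - (monicPoly x.1).eval w * (derivative (monicPoly x.2)).eval w)
      - r * (monicPoly x.1).eval w * (monicPoly x.2).eval w = 0 := by
    simpa [critPoly] using hw.eq_zero
  have hP : ∀ u, u * (monicPoly x.2).eval u = 0 → (monicPoly x.1).eval u ≠ 0 := fun u hu hPu => by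
    obtain ⟨a, b, hab⟩ := hcop
    simpa [hPu, hu] using congrArg (eval u) hab
  have hr' : (r : ℂ) ≠ 0 := Nat.cast_ne_zero.2 (by omega)
  have h0 : w ≠ 0 := by
    rintro rfl
    have := hP 0 (zero_mul _)
    simp_all
  refine ⟨h0, fun hQ => ?_⟩
  have hPw := hP w (by rw [hQ, mul_zero])
  have hQ' : (derivative (monicPoly x.2)).eval w ≠ 0 := fun h => by
    obtain ⟨a, b, hab⟩ := hsep
    simpa [hQ, h] using congrArg (eval w) hab
  simp_all

theorem eval_derivative_critPoly_ne_zero (hr : 1 ≤ r) {x : Coef ℓ r np}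
    (hx : x ∈ semisimpleLocus ℓ r np) {q : ℂ} (hq : (critPoly x).IsRoot q) :
    (derivative (critPoly x)).eval q ≠ 0 := by
  have hq' : q ∈ critSet x := by
    rw [critSet_eq_roots hr hx.1, Finset.mem_coe, Multiset.mem_toFinset,
      mem_roots (natDegree_critPoly x).1]
    exact hq
  have := hx.2 q hq'
  rw [deriv_deriv_lam hq'] at this
  exact fun h => this (by rw [h, zero_div])

theorem card_roots_critPoly (hr : 1 ≤ r) {x : Coef ℓ r np} (hx : x ∈ semisimpleLocus ℓ r np) :
    (critPoly x).roots.toFinset.card = ℓ + r + np + 1 + np := by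
  obtain ⟨h0, hd⟩ := natDegree_critPoly x
  have hnodup : (critPoly x).roots.Nodup := by
    classical
    rw [Multiset.nodup_iff_count_le_one]
    intro a
    rw [count_roots]
    by_contra hlt
    push Not at hlt
    obtain ⟨ha, ha'⟩ := (one_lt_rootMultiplicity_iff_isRoot h0).1 hlt
    exact eval_derivative_critPoly_ne_zero hr hx ha ha'
  rw [Multiset.toFinset_card_of_nodup hnodup, ← hd]
  exact IsAlgClosed.card_roots_eq_natDegree

/-! ### Holomorphic branches of the critical points -/

theorem contDiff_eval_fst (k : ℕ) :
    ContDiff ℂ ω fun p : Coef ℓ r np × ℂ => (derivative^[k] (monicPoly p.1.1)).eval p.2 :=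
  (contDiff_eval_iterate_derivative _ k).comp
    ((contDiff_fst.comp contDiff_fst).prodMk contDiff_snd)

theorem contDiff_eval_snd (k : ℕ) :
    ContDiff ℂ ω fun p : Coef ℓ r np × ℂ => (derivative^[k] (monicPoly p.1.2)).eval p.2 :=
  (contDiff_eval_iterate_derivative _ k).comp
    ((contDiff_snd.comp contDiff_fst).prodMk contDiff_snd)

theorem contDiff_eval_critPoly :
    ContDiff ℂ ω fun p : Coef ℓ r np × ℂ => (critPoly p.1).eval p.2 := by
  have hP := contDiff_eval_fst (ℓ := ℓ) (r := r) (np := np)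
  have hQ := contDiff_eval_snd (ℓ := ℓ) (r := r) (np := np)
  simp only [critPoly, eval_sub, eval_mul, eval_X, eval_natCast]
  exact (contDiff_snd.mul (((hP 1).mul (hQ 0)).sub ((hP 0).mul (hQ 1)))).sub
    ((contDiff_const.mul (hP 0)).mul (hQ 0))

theorem contDiff_eval_derivative_critPoly :
    ContDiff ℂ ω fun p : Coef ℓ r np × ℂ => (derivative (critPoly p.1)).eval p.2 := by
  have hP := contDiff_eval_fst (ℓ := ℓ) (r := r) (np := np)
  have hQ := contDiff_eval_snd (ℓ := ℓ) (r := r) (np := np)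
  have heq : (fun p : Coef ℓ r np × ℂ => (derivative (critPoly p.1)).eval p.2) = fun p =>
      ((derivative^[1] (monicPoly p.1.1)).eval p.2 * (derivative^[0] (monicPoly p.1.2)).eval p.2
        - (derivative^[0] (monicPoly p.1.1)).eval p.2 *
          (derivative^[1] (monicPoly p.1.2)).eval p.2)
      + p.2 * ((derivative^[2] (monicPoly p.1.1)).eval p.2 *
          (derivative^[0] (monicPoly p.1.2)).eval p.2
        - (derivative^[0] (monicPoly p.1.1)).eval p.2 *
          (derivative^[2] (monicPoly p.1.2)).eval p.2)
      - r * ((derivative^[1] (monicPoly p.1.1)).eval p.2 *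
          (derivative^[0] (monicPoly p.1.2)).eval p.2
        + (derivative^[0] (monicPoly p.1.1)).eval p.2 *
          (derivative^[1] (monicPoly p.1.2)).eval p.2) := by
    funext p
    simp [critPoly]
    ring
  rw [heq]
  exact ((((hP 1).mul (hQ 0)).sub ((hP 0).mul (hQ 1))).add
    (contDiff_snd.mul (((hP 2).mul (hQ 0)).sub ((hP 0).mul (hQ 2))))).sub
    (contDiff_const.mul (((hP 1).mul (hQ 0)).add ((hP 0).mul (hQ 1))))

/-- Implicit function theorem for `critPoly y (w) = 0`: the partial derivative in `w` is nonzero at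
a simple root, and continuity keeps the branch away from the poles. -/
theorem exists_critBranch (hr : 1 ≤ r) {x : Coef ℓ r np} (hx : x ∈ semisimpleLocus ℓ r np)
    {q₀ : ℂ} (hq : q₀ ∈ critSet x) : ∃ q : Coef ℓ r np → ℂ, q x = q₀ ∧ IsCritBranch x q := by
  obtain ⟨hreg, hroot⟩ := mem_critSet_iff.1 hq
  set F : Coef ℓ r np × ℂ → ℂ := fun p => (critPoly p.1).eval p.2 with hF
  have hFs : ContDiffAt ℂ ω F (x, q₀) := contDiff_eval_critPoly.contDiffAt
  have hω : (ω : WithTop ℕ∞) ≠ 0 := by simp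
  have hpart : (fderiv ℂ F (x, q₀) ∘L .inr ℂ (Coef ℓ r np) ℂ) 1 =
      (derivative (critPoly x)).eval q₀ := by
    have h1 : HasFDerivAt F (fderiv ℂ F (x, q₀)) (x, q₀) :=
      (hFs.differentiableAt hω).hasFDerivAt
    have h2 : HasDerivAt (fun w : ℂ => ((x, w) : Coef ℓ r np × ℂ)) (0, 1) q₀ :=
      (hasDerivAt_const q₀ x).prodMk (hasDerivAt_id q₀)
    have h3 := h1.comp_hasDerivAt q₀ h2
    exact h3.unique ((critPoly x).hasDerivAt q₀)
  have hinv : (fderiv ℂ F (x, q₀) ∘L .inr ℂ (Coef ℓ r np) ℂ).IsInvertible := by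
    have hne := eval_derivative_critPoly_ne_zero hr hx hroot
    refine ⟨ContinuousLinearEquiv.unitsEquivAut ℂ (Units.mk0 _ hne), ?_⟩
    ext
    simpa using hpart.symm
  refine ⟨hFs.implicitFunction hω hinv, hFs.implicitFunction_apply_self hω hinv, ?_, ?_⟩
  · exact (hFs.contDiffAt_implicitFunction hω hinv).analyticAt
  · have hcont : ContinuousAt (hFs.implicitFunction hω hinv) x :=
      (hFs.contDiffAt_implicitFunction hω hinv).continuousAt
    have hx0 : hFs.implicitFunction hω hinv x = q₀ := hFs.implicitFunction_apply_self hω hinv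
    have hQ : ContinuousAt (fun y : Coef ℓ r np =>
        (monicPoly y.2).eval (hFs.implicitFunction hω hinv y)) x := by
      have := (contDiff_eval_iterate_derivative np 0).continuous.continuousAt
        (x := (x.2, hFs.implicitFunction hω hinv x))
      exact this.comp (f := fun y : Coef ℓ r np => (y.2, hFs.implicitFunction hω hinv y))
        (continuousAt_snd.prodMk hcont)
    have e1 := hcont.eventually_ne (y := 0) (by rw [hx0]; exact hreg.1)
    have e2 := hQ.eventually_ne (y := 0) (by rw [hx0]; exact hreg.2)
    filter_upwards [e1, e2, hFs.eventually_apply_implicitFunction hω hinv] with y h1 h2 h3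
    exact mem_critSet_iff.2 ⟨⟨h1, h2⟩, h3.trans hroot⟩

/-- Near a semisimple point, the critical points are the values of holomorphic branches. -/
theorem exists_critBranches (hr : 1 ≤ r) {x : Coef ℓ r np} (hx : x ∈ semisimpleLocus ℓ r np) :
    ∃ q : ℂ → Coef ℓ r np → ℂ,
      (∀ s ∈ (critPoly x).roots.toFinset, q s x = s ∧ IsCritBranch x (q s)) ∧
      ∀ᶠ y in 𝓝 x, Set.InjOn (fun s => q s y) (critPoly x).roots.toFinset ∧
        critSet y = (fun s => q s y) '' (critPoly x).roots.toFinset := by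
  classical
  have hex : ∀ s : ℂ, ∃ q : Coef ℓ r np → ℂ,
      s ∈ (critPoly x).roots.toFinset → q x = s ∧ IsCritBranch x q := fun s => by
    by_cases hs : s ∈ (critPoly x).roots.toFinset
    · obtain ⟨q, hq⟩ := exists_critBranch hr hx
        (q₀ := s) (by rw [critSet_eq_roots hr hx.1]; exact hs)
      exact ⟨q, fun _ => hq⟩
    · exact ⟨0, fun h => absurd h hs⟩
  choose q hq using hex
  refine ⟨q, hq, ?_⟩
  have hinj : ∀ᶠ y in 𝓝 x, ∀ s ∈ (critPoly x).roots.toFinset,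
      ∀ t ∈ (critPoly x).roots.toFinset, s ≠ t → q s y ≠ q t y := by
    rw [eventually_all_finset]
    intro s hs
    rw [eventually_all_finset]
    intro t ht
    by_cases hst : s = t
    · exact Eventually.of_forall fun y h => absurd hst h
    · have hne : q s x ≠ q t x := by rwa [(hq s hs).1, (hq t ht).1]
      exact ((hq s hs).2.1.continuousAt.ne_iff_eventually_ne (hq t ht).2.1.continuousAt).1 hne
        |>.mono fun y h _ => h
  have hcrit : ∀ᶠ y in 𝓝 x, ∀ s ∈ (critPoly x).roots.toFinset, q s y ∈ critSet y :=
    (eventually_all_finset _).2 fun s hs => (hq s hs).2.2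
  filter_upwards [hinj, hcrit] with y h1 h2
  have hI : Set.InjOn (fun s => q s y) (critPoly x).roots.toFinset := fun s hs t ht hst => by
    by_contra hne
    exact h1 s hs t ht hne hst
  refine ⟨hI, ?_⟩
  have hsub : (critPoly x).roots.toFinset.image (fun s => q s y) ⊆
      (critPoly y).roots.toFinset := fun w hw => by
    obtain ⟨s, hs, rfl⟩ := Finset.mem_image.1 hw
    rw [Multiset.mem_toFinset, mem_roots (natDegree_critPoly y).1]
    exact (mem_critSet_iff.1 (h2 s hs)).2
  -- The branches already give as many distinct roots as the degree, which does not depend on `y`,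
  -- so no other critical point exists.
  have heq := Finset.eq_of_subset_of_card_le hsub (by
    rw [Finset.card_image_of_injOn hI, card_roots_critPoly hr hx, ← (natDegree_critPoly y).2]
    exact (Multiset.toFinset_card_le _).trans (card_roots' _))
  refine Set.Subset.antisymm (fun w hw => ?_) ?_
  · have : w ∈ (critPoly y).roots.toFinset := by
      rw [Multiset.mem_toFinset, mem_roots (natDegree_critPoly y).1]
      exact (mem_critSet_iff.1 hw).2
    rw [← heq] at this
    simpa using this
  · rintro _ ⟨s, hs, rfl⟩
    exact h2 s hs

/-! ### The Euler vector field in the coordinates `(a, b)` -/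

/-- The vector field `(ℓ + 1)⁻¹ (∑ (n_z - i) a_i ∂_{a_i} + ∑ (n_p - j) b_j ∂_{b_j})`. -/
def eulerField (ℓ r np : ℕ) : Coef ℓ r np →ₗ[ℂ] Coef ℓ r np where
  toFun x := ((1 / ((ℓ : ℂ) + 1)) • wgen x.1, (1 / ((ℓ : ℂ) + 1)) • wgen x.2)
  map_add' x y := by
    ext i <;> simp [wgen] <;> ring
  map_smul' c x := by
    ext i <;> simp [wgen] <;> ring

theorem eulerField_apply (x : Coef ℓ r np) : eulerField ℓ r np x =
    ((1 / ((ℓ : ℂ) + 1)) • wgen x.1, (1 / ((ℓ : ℂ) + 1)) • wgen x.2) := rfl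

theorem hasFDerivAt_eulerField (x : Coef ℓ r np) :
    HasFDerivAt (eulerField ℓ r np) (LinearMap.toContinuousLinearMap (eulerField ℓ r np)) x :=
  (LinearMap.toContinuousLinearMap (eulerField ℓ r np)).hasFDerivAt

theorem fderiv_eulerField (x v : Coef ℓ r np) :
    fderiv ℂ (eulerField ℓ r np) x v = eulerField ℓ r np v := by
  rw [(hasFDerivAt_eulerField x).fderiv]; rfl

theorem lowPoly_smul {n : ℕ} (a : ℂ) (c : Fin n → ℂ) : lowPoly (a • c) = C a * lowPoly c := by
  simp [lowPoly, Finset.mul_sum, mul_assoc]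

/-- Infinitesimal form of `λ_{tx}(t w) = t^(ℓ+1) λ_x(w)`, read off from `critPoly_eq`. -/
theorem lieLam_eulerField {x : Coef ℓ r np} {w : ℂ} (hw : w ∈ regSet x) :
    lieLam x (eulerField ℓ r np x) w = lam x w - w * deriv (lam x) w / ((ℓ : ℂ) + 1) := by
  have hl : (ℓ : ℂ) + 1 ≠ 0 := Nat.cast_add_one_ne_zero ℓ
  obtain ⟨h1, h2⟩ := id hw
  rw [lieLam_eq hw, deriv_lam hw, critPoly_eq, eulerField_apply, lam]
  simp only [lowPoly_smul, eval_sub, eval_mul, eval_C]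
  field_simp
  ring

/-! ### Critical values -/

theorem differentiableAt_lam_uncurry {x : Coef ℓ r np} {w : ℂ} (hw : w ∈ regSet x) :
    DifferentiableAt ℂ (fun p : Coef ℓ r np × ℂ => lam p.1 p.2) (x, w) := by
  have hω : (ω : WithTop ℕ∞) ≠ 0 := by simp
  have hP := ((contDiff_eval_fst (ℓ := ℓ) (r := r) (np := np) 0).differentiable hω) (x, w)
  have hQ := ((contDiff_eval_snd (ℓ := ℓ) (r := r) (np := np) 0).differentiable hω) (x, w)
  have hD : DifferentiableAt ℂ (fun p : Coef ℓ r np × ℂ => p.2 ^ r * (monicPoly p.1.2).eval p.2)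
      (x, w) := (differentiableAt_snd.pow r).mul hQ
  simp only [lam, div_eq_mul_inv]
  exact hP.fun_mul (hD.fun_inv (mul_ne_zero (pow_ne_zero r hw.1) hw.2))

/-- The derivative of a critical value along `v` is `v(λ)` at the critical point. -/
theorem fderiv_critValue {x : Coef ℓ r np} {q : Coef ℓ r np → ℂ} (hq : IsCritBranch x q)
    (v : Coef ℓ r np) : fderiv ℂ (fun y => lam y (q y)) x v = lieLam x v (q x) := by
  have hqx : q x ∈ critSet x := hq.2.self_of_nhds
  have hreg := critSet_subset_regSet x hqx
  have hG := (differentiableAt_lam_uncurry hreg).hasFDerivAt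
  set G' := fderiv ℂ (fun p : Coef ℓ r np × ℂ => lam p.1 p.2) (x, q x)
  have hd := hq.1.differentiableAt.hasFDerivAt
  have h1 := hG.comp (f := fun y => (y, q y)) x ((hasFDerivAt_id x).prodMk hd)
  have h2 := hG.comp (f := fun y => (y, q x)) x ((hasFDerivAt_id x).prodMk (hasFDerivAt_const _ x))
  have h3 : deriv (lam x) (q x) = G' (0, 1) :=
    (hG.comp_hasDerivAt (f := fun w => (x, w)) (q x)
      ((hasDerivAt_const (q x) x).prodMk (hasDerivAt_id (q x)))).deriv
  have e1 : fderiv ℂ (fun y => lam y (q y)) x v = G' (v, fderiv ℂ q x v) := by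
    have : HasFDerivAt (fun y => lam y (q y)) _ x := h1
    rw [this.fderiv]; simp
  have e2 : lieLam x v (q x) = G' (v, 0) := by
    have : HasFDerivAt (fun y => lam y (q x)) _ x := h2
    rw [lieLam, this.fderiv]; simp
  -- The motion of the critical point contributes `λ'(q)` times its velocity, which is zero.
  have e3 : ((v, fderiv ℂ q x v) : Coef ℓ r np × ℂ) =
      (v, 0) + (fderiv ℂ q x v) • ((0 : Coef ℓ r np), (1 : ℂ)) := by simp
  rw [e1, e2, e3, map_add, map_smul, ← h3, hqx.2.2, smul_zero, add_zero]

theorem eulerField_canonical {x : Coef ℓ r np} {q : Coef ℓ r np → ℂ} (hq : IsCritBranch x q) :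
    fderiv ℂ (fun y => lam y (q y)) x (eulerField ℓ r np x) = lam x (q x) := by
  have hqx : q x ∈ critSet x := hq.2.self_of_nhds
  rw [fderiv_critValue hq, lieLam_eulerField (critSet_subset_regSet x hqx), hqx.2.2, mul_zero,
    zero_div, sub_zero]

/-! ### A tangent vector is determined by its action on the critical values -/

/-- The numerator `v₁ Q - P v₂` has more roots than its degree allows, hence is zero. Then `Q`
divides `P v₂`, so divides `v₂` by coprimality, and `deg v₂ < deg Q` forces `v₂ = 0`, then `v₁ = 0`.
-/
theorem eq_zero_of_lieLam_eq_zero (hr : 1 ≤ r) {x : Coef ℓ r np}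
    (hx : x ∈ semisimpleLocus ℓ r np) {v : Coef ℓ r np}
    (hv : ∀ q ∈ critSet x, lieLam x v q = 0) : v = 0 := by
  obtain ⟨m1, d1⟩ := monicPoly_monic x.1
  obtain ⟨m2, d2⟩ := monicPoly_monic x.2
  have hnum : lowPoly v.1 * monicPoly x.2 - monicPoly x.1 * lowPoly v.2 = 0 := by
    refine eq_zero_of_degree_lt_of_eval_finset_eq_zero (critPoly x).roots.toFinset ?_ ?_
    · rw [card_roots_critPoly hr hx]
      exact degree_lieNum_lt x v
    · intro q hq
      have hq' : q ∈ critSet x := by rw [critSet_eq_roots hr hx.1]; exact hq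
      have hreg := critSet_subset_regSet x hq'
      have := hv q hq'
      rw [lieLam_eq hreg] at this
      exact (div_eq_zero_iff.1 this).resolve_right
        (mul_ne_zero (pow_ne_zero _ hreg.1) (pow_ne_zero _ hreg.2))
  have hcop : IsCoprime (monicPoly x.2) (monicPoly x.1) := hx.1.2.2.of_mul_right_right.symm
  have h2 : lowPoly v.2 = 0 := by
    refine eq_zero_of_dvd_of_degree_lt (hcop.dvd_of_dvd_mul_left (Dvd.intro_left (lowPoly v.1) ?_))
      ?_
    · exact sub_eq_zero.1 hnum
    · rw [degree_eq_natDegree m2.ne_zero, d2]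
      exact lowPoly_degree_lt v.2
  rw [h2, mul_zero, sub_zero] at hnum
  have h1 := (mul_eq_zero.1 hnum).resolve_right m2.ne_zero
  exact Prod.ext (lowPoly_injective (h1.trans lowPoly_zero.symm))
    (lowPoly_injective (h2.trans lowPoly_zero.symm))

theorem eq_eulerField_of_mem_semisimpleLocus (hr : 1 ≤ r) {E : Coef ℓ r np → Coef ℓ r np}
    (hE : IsEulerField ℓ r np E) {x : Coef ℓ r np} (hx : x ∈ semisimpleLocus ℓ r np) :
    E x = eulerField ℓ r np x := by
  refine sub_eq_zero.1 (eq_zero_of_lieLam_eq_zero hr hx fun q₀ hq₀ => ?_)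
  obtain ⟨q, rfl, hq⟩ := exists_critBranch hr hx hq₀
  have h1 := hE.canonical x hx q hq
  have h2 := eulerField_canonical hq
  rw [fderiv_critValue hq] at h1 h2
  rw [lieLam] at h1 h2 ⊢
  rw [map_sub, h1, h2, sub_self]

/-! ### Density of the semisimple locus -/

theorem lowPoly_lowCoeffs {n : ℕ} {P : ℂ[X]} (hP : P.degree < (n : WithBot ℕ)) :
    lowPoly (lowCoeffs n P) = P := by
  ext i
  by_cases hi : i < n
  · exact lowPoly_coeff (lowCoeffs n P) ⟨i, hi⟩
  · have hn : (n : WithBot ℕ) ≤ i := by exact_mod_cast not_lt.1 hi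
    rw [coeff_eq_zero_of_degree_lt ((lowPoly_degree_lt _).trans_le hn),
      coeff_eq_zero_of_degree_lt (hP.trans_le hn)]

/-- The point whose superpotential is `λ + t / w`. -/
def addPole (x : Coef ℓ r np) (t : ℂ) : Coef ℓ r np :=
  (x.1 + t • lowCoeffs _ (X ^ (r - 1) * monicPoly x.2), x.2)

theorem monicPoly_addPole (hr : 1 ≤ r) (x : Coef ℓ r np) (t : ℂ) :
    monicPoly (addPole x t).1 = monicPoly x.1 + C t * X ^ (r - 1) * monicPoly x.2 := by
  obtain ⟨m2, d2⟩ := monicPoly_monic x.2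
  have hd : (X ^ (r - 1) * monicPoly x.2).degree < ((ℓ + r + np + 1 : ℕ) : WithBot ℕ) := by
    rw [degree_eq_natDegree ((monic_X_pow _).mul m2).ne_zero, (monic_X_pow _).natDegree_mul m2,
      natDegree_X_pow, d2]
    exact_mod_cast (by omega : r - 1 + np < ℓ + r + np + 1)
  have hadd : lowPoly (addPole x t).1 =
      lowPoly x.1 + C t * (X ^ (r - 1) * monicPoly x.2) := by
    rw [addPole, ← lowPoly_lowCoeffs hd, ← lowPoly_smul, lowPoly_lowCoeffs hd]
    simp [lowPoly, add_mul, Finset.sum_add_distrib]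
  rw [monicPoly_eq, monicPoly_eq, hadd]
  ring

/-- `λ'` changes by `-t / w^2`, here multiplied by the denominator `w^(r+1) Q^2`. -/
theorem critPoly_addPole (hr : 1 ≤ r) (x : Coef ℓ r np) (t : ℂ) :
    critPoly (addPole x t) = critPoly x - C t * (X ^ (r - 1) * monicPoly x.2 ^ 2) := by
  rw [critPoly, monicPoly_addPole hr, critPoly, show (addPole x t).2 = x.2 from rfl]
  obtain ⟨k, rfl⟩ : ∃ k, r = k + 1 := ⟨r - 1, by omega⟩
  have hX : (X : ℂ[X]) * ((k : ℂ[X]) * X ^ (k - 1)) = (k : ℂ[X]) * X ^ k := by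
    rcases k with _ | m
    · simp
    · rw [Nat.add_sub_cancel, pow_succ]; ring
  simp only [Nat.add_sub_cancel, derivative_add, derivative_mul, derivative_C, derivative_X_pow,
    map_natCast, Nat.cast_add, Nat.cast_one]
  linear_combination (C t * monicPoly x.2 ^ 2) * hX

/-- The two polynomials have different degrees, so the leading terms of the Wronskian do not cancel.
-/
theorem wronskian_critPoly_ne_zero (x : Coef ℓ r np) :
    derivative (critPoly x) * (X ^ (r - 1) * monicPoly x.2 ^ 2) -
      critPoly x * derivative (X ^ (r - 1) * monicPoly x.2 ^ 2) ≠ 0 := by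
  obtain ⟨h0, hd⟩ := natDegree_critPoly x
  obtain ⟨m2, d2⟩ := monicPoly_monic x.2
  have hm : (X ^ (r - 1) * monicPoly x.2 ^ 2).Monic := (monic_X_pow _).mul (m2.pow 2)
  have hmd : (X ^ (r - 1) * monicPoly x.2 ^ 2).natDegree = r - 1 + 2 * np := by
    rw [(monic_X_pow _).natDegree_mul (m2.pow 2), natDegree_X_pow, m2.natDegree_pow, d2]
  intro h
  have hl := congrArg leadingCoeff (sub_eq_zero.1 h)
  rw [leadingCoeff_mul, leadingCoeff_mul (critPoly x), leadingCoeff_derivative, leadingCoeff_derivative,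
    hm.leadingCoeff, one_mul, mul_one, hmd, hd] at hl
  have := mul_left_cancel₀ (leadingCoeff_ne_zero.2 h0) hl
  have : ℓ + r + np + 1 + np = r - 1 + 2 * np := by exact_mod_cast this
  omega

/-- A double root `q` of `critPoly x - t D` away from the poles is a zero of the Wronskian of
`critPoly x` and `D`, and `t` is recovered as the quotient of their values at `q`. So only finitely
many `t` are bad. -/
theorem eventually_addPole_mem (hr : 1 ≤ r) {x : Coef ℓ r np} (hx : x ∈ hurwitzSpace ℓ r np) :
    ∀ᶠ t in 𝓝[≠] (0 : ℂ), addPole x t ∈ semisimpleLocus ℓ r np := by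
  classical
  obtain ⟨hsep, hQ0, hcop⟩ := hx
  set D := X ^ (r - 1) * monicPoly x.2 ^ 2 with hD
  set W := derivative (critPoly x) * D - critPoly x * derivative D with hW
  have hW0 : W ≠ 0 := wronskian_critPoly_ne_zero x
  -- Removing `0` makes the complement of this finite set a neighbourhood of `0`; the value `t = 0`
  -- is excluded by the punctured filter.
  set B := (W.roots.toFinset.image fun w => (critPoly x).eval w / D.eval w).erase 0 with hB
  have hBev : ∀ᶠ t in 𝓝 (0 : ℂ), t ∉ B :=
    B.finite_toSet.isClosed.isOpen_compl.eventually_mem (by simp [hB])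
  have hP0 : (monicPoly x.1).eval 0 ≠ 0 := fun h => by
    obtain ⟨a, b, hab⟩ := hcop
    simpa [h] using congrArg (eval 0) hab
  have h0ev : ∀ᶠ t in 𝓝 (0 : ℂ),
      (monicPoly x.1 + C t * X ^ (r - 1) * monicPoly x.2).eval 0 ≠ 0 := by
    have hc : ContinuousAt (fun t : ℂ =>
        (monicPoly x.1 + C t * X ^ (r - 1) * monicPoly x.2).eval 0) 0 := by
      simp only [eval_add, eval_mul, eval_C]
      fun_prop
    exact hc.eventually_ne (by simpa using hP0)
  filter_upwards [nhdsWithin_le_nhds hBev, nhdsWithin_le_nhds h0ev, self_mem_nhdsWithin]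
    with t htB ht0 hne
  refine ⟨⟨hsep, hQ0, ?_⟩, fun q hq hq2 => htB ?_⟩
  · rw [monicPoly_addPole hr]
    refine IsCoprime.mul_right ?_ ?_
    · refine ((irreducible_X.coprime_iff_not_dvd).2 fun hdvd => ht0 ?_).symm
      rw [← coeff_zero_eq_eval_zero]
      exact X_dvd_iff.1 hdvd
    -- The numerator changes by a multiple of `Q`, so coprimality with `Q` persists.
    · exact hcop.of_mul_right_right.add_mul_right_left _
  · obtain ⟨hreg, hroot⟩ := mem_critSet_iff.1 hq
    rw [deriv_deriv_lam hq, div_eq_zero_iff, or_iff_left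
      (mul_ne_zero (pow_ne_zero _ hreg.1) (pow_ne_zero _ hreg.2)), critPoly_addPole hr, ← hD] at hq2
    rw [critPoly_addPole hr, ← hD, IsRoot.def] at hroot
    simp only [derivative_sub, derivative_C_mul, eval_sub, eval_mul, eval_C] at hq2 hroot
    have hDq : D.eval q ≠ 0 := by
      rw [hD, eval_mul, eval_pow, eval_pow, eval_X]
      exact mul_ne_zero (pow_ne_zero _ hreg.1) (pow_ne_zero _ hreg.2)
    refine Finset.mem_erase.2 ⟨hne, Finset.mem_image.2 ⟨q, ?_, ?_⟩⟩
    · rw [Multiset.mem_toFinset, mem_roots hW0, IsRoot.def, hW]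
      simp only [eval_sub, eval_mul]
      linear_combination D.eval q * hq2 - (derivative D).eval q * hroot
    · rw [div_eq_iff hDq]
      linear_combination hroot

theorem eq_eulerField (hr : 1 ≤ r) {E : Coef ℓ r np → Coef ℓ r np}
    (hE : IsEulerField ℓ r np E) {x : Coef ℓ r np} (hx : x ∈ hurwitzSpace ℓ r np) :
    E x = eulerField ℓ r np x := by
  have hev := eventually_addPole_mem hr hx
  have hlim : Tendsto (addPole x) (𝓝[≠] 0) (𝓝[hurwitzSpace ℓ r np] x) := by
    refine tendsto_nhdsWithin_iff.2 ⟨?_, hev.mono fun t ht => ht.1⟩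
    have hc : Continuous (addPole x) := by unfold addPole; fun_prop
    have h0 : addPole x 0 = x := by simp [addPole]
    have := hc.tendsto 0
    rw [h0] at this
    exact this.mono_left nhdsWithin_le_nhds
  have h1 : Tendsto (fun t => E (addPole x t)) (𝓝[≠] 0) (𝓝 (E x)) :=
    Tendsto.comp (hE.holomorphic x hx).continuousWithinAt hlim
  have h2 : Tendsto (fun t => eulerField ℓ r np (addPole x t)) (𝓝[≠] 0)
      (𝓝 (eulerField ℓ r np x)) :=
    (hasFDerivAt_eulerField x).continuousAt.tendsto.comp (hlim.mono_right nhdsWithin_le_nhds)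
  refine tendsto_nhds_unique (h1.congr' ?_) h2
  exact hev.mono fun t ht => eq_eulerField_of_mem_semisimpleLocus hr hE ht

/-! ### Homogeneity under the scaling `w ↦ t w` -/

/-- The scaling which multiplies the zeros and the poles of the superpotential by `t`. -/
def scale (t : ℂ) (x : Coef ℓ r np) : Coef ℓ r np := (wscale t x.1, wscale t x.2)

@[simp] theorem scale_one (x : Coef ℓ r np) : scale 1 x = x := by
  ext i <;> simp [scale, wscale]

theorem scale_scale_inv {t : ℂ} (ht : t ≠ 0) (x : Coef ℓ r np) : scale t (scale t⁻¹ x) = x := by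
  ext i <;> simp [scale, wscale, ht]

theorem hasDerivAt_scale (x : Coef ℓ r np) :
    HasDerivAt (fun t => scale t x) (((ℓ : ℂ) + 1) • eulerField ℓ r np x) 1 := by
  have hl : (ℓ : ℂ) + 1 ≠ 0 := Nat.cast_add_one_ne_zero ℓ
  have h := (hasDerivAt_wscale x.1).prodMk (hasDerivAt_wscale x.2)
  refine h.congr_deriv ?_
  rw [eulerField_apply, Prod.smul_mk, smul_smul, smul_smul, mul_one_div_cancel hl, one_smul,
    one_smul]

theorem hasDerivAt_scale_inv (x : Coef ℓ r np) :
    HasDerivAt (fun t => scale t⁻¹ x) (-(((ℓ : ℂ) + 1) • eulerField ℓ r np x)) 1 := by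
  have h1 : HasDerivAt (fun t : ℂ => t⁻¹) (-1) 1 := by
    simpa using hasDerivAt_inv (one_ne_zero (α := ℂ))
  have h2 : HasDerivAt (fun t => scale t x) (((ℓ : ℂ) + 1) • eulerField ℓ r np x) (1 : ℂ)⁻¹ := by
    rw [inv_one]; exact hasDerivAt_scale x
  exact (h2.scomp 1 h1).congr_deriv (by simp)

theorem lam_scale {t : ℂ} (ht : t ≠ 0) (x : Coef ℓ r np) (w : ℂ) :
    lam (scale t x) (t * w) = t ^ (ℓ + 1) * lam x w := by
  have h : t ^ (ℓ + r + np + 1) = t ^ (ℓ + 1) * (t ^ r * t ^ np) := by ring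
  simp only [lam, scale, eval_monicPoly_wscale, mul_pow]
  rw [h, mul_mul_mul_comm, mul_assoc, mul_div_assoc,
    mul_div_mul_left _ _ (mul_ne_zero (pow_ne_zero r ht) (pow_ne_zero np ht))]

theorem lam_scale_eq {t : ℂ} (ht : t ≠ 0) (x : Coef ℓ r np) :
    lam (scale t x) = fun u => t ^ (ℓ + 1) * lam x (t⁻¹ * u) := by
  funext u
  rw [← lam_scale ht, mul_inv_cancel_left₀ ht]

theorem deriv_lam_scale {t : ℂ} (ht : t ≠ 0) (x : Coef ℓ r np) :
    deriv (lam (scale t x)) = fun u => t ^ (ℓ + 1) * t⁻¹ * deriv (lam x) (t⁻¹ * u) := by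
  funext u
  rw [lam_scale_eq ht, deriv_const_mul_field, deriv_comp_mul_left, smul_eq_mul, mul_assoc]

theorem deriv_deriv_lam_scale {t : ℂ} (ht : t ≠ 0) (x : Coef ℓ r np) (w : ℂ) :
    deriv (deriv (lam (scale t x))) (t * w) =
      t ^ (ℓ + 1) * t⁻¹ ^ 2 * deriv (deriv (lam x)) w := by
  rw [deriv_lam_scale ht, deriv_const_mul_field, deriv_comp_mul_left, smul_eq_mul,
    inv_mul_cancel_left₀ ht]
  ring

theorem scale_mem_regSet {t : ℂ} (ht : t ≠ 0) {x : Coef ℓ r np} {w : ℂ} :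
    t * w ∈ regSet (scale t x) ↔ w ∈ regSet x := by
  simp [regSet, scale, eval_monicPoly_wscale, ht]

theorem critSet_scale {t : ℂ} (ht : t ≠ 0) (x : Coef ℓ r np) :
    critSet (scale t x) = (fun w => t * w) '' critSet x := by
  have key : ∀ w, t * w ∈ critSet (scale t x) ↔ w ∈ critSet x := fun w => by
    simp [critSet, scale, eval_monicPoly_wscale, ht]
    simp [← scale.eq_1, deriv_lam_scale ht, ht]
  ext u
  refine ⟨fun hu => ⟨t⁻¹ * u, ?_, mul_inv_cancel_left₀ ht u⟩, ?_⟩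
  · rwa [← key, mul_inv_cancel_left₀ ht]
  · rintro ⟨w, hw, rfl⟩
    exact (key w).2 hw

/-- The dilation is linear in the coefficients, so `scale t v` is the pushforward of the tangent
vector `v`. -/
theorem lieLam_scale {t : ℂ} (ht : t ≠ 0) {x : Coef ℓ r np} {w : ℂ} (hw : w ∈ regSet x)
    (v : Coef ℓ r np) :
    lieLam (scale t x) (scale t v) (t * w) = t ^ (ℓ + 1) * lieLam x v w := by
  rw [lieLam_eq ((scale_mem_regSet ht).2 hw), lieLam_eq hw]
  obtain ⟨h1, h2⟩ := hw
  simp only [scale, eval_sub, eval_mul, eval_lowPoly_wscale, eval_monicPoly_wscale]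
  field_simp
  ring

/-- Weights: `k + 1` factors `t^(ℓ+1)` above, `t^(ℓ+1) t^(-2)` from `λ''` below, and `t^(-2)` from
the squared density of `ω`. The powers `t^(-2)` cancel. -/
theorem critTerm_scale {k : ℕ} {t : ℂ} (ht : t ≠ 0) {x : Coef ℓ r np} {q : ℂ}
    (hq : q ∈ regSet x) (v : Fin (k + 1) → Coef ℓ r np) :
    critTerm (scale t x) v (t * q) =
      (t ^ (ℓ + 1)) ^ k * critTerm x (fun j => scale t⁻¹ (v j)) q := by
  have h : ∀ j, lieLam (scale t x) (v j) (t * q) = t ^ (ℓ + 1) * lieLam x (scale t⁻¹ (v j)) q :=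
    fun j => by rw [← lieLam_scale ht hq, scale_scale_inv ht]
  have h0 := hq.1
  simp only [critTerm, h, Finset.prod_mul_distrib, Finset.prod_const, Finset.card_univ,
    Fintype.card_fin, deriv_deriv_lam_scale ht, omegaDensity]
  rw [pow_succ (t ^ (ℓ + 1)) k]
  -- At a degenerate point both sides are zero by the convention on division.
  by_cases h2 : deriv (deriv (lam x)) q = 0
  · simp [h2]
  · field_simp

/-! ### The Lie derivatives -/

theorem resForm_eq_sum (hr : 1 ≤ r) {k : ℕ} {x : Coef ℓ r np} (hx : x ∈ semisimpleLocus ℓ r np)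
    (v : Fin k → Coef ℓ r np) :
    resForm x v = ∑ q ∈ (critPoly x).roots.toFinset, critTerm x v q := by
  rw [resForm_eq hx.2, critSet_eq_roots hr hx.1, finsum_mem_coe_finset]

theorem resForm_scale (hr : 1 ≤ r) {k : ℕ} {x : Coef ℓ r np} (hx : x ∈ semisimpleLocus ℓ r np)
    {t : ℂ} (ht : t ≠ 0) (v : Fin (k + 1) → Coef ℓ r np) :
    resForm (scale t x) v = ∑ q ∈ (critPoly x).roots.toFinset,
      (t ^ (ℓ + 1)) ^ k * critTerm x (fun j => scale t⁻¹ (v j)) q := by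
  have hinj : Set.InjOn (fun w => t * w) (critSet x) := (mul_right_injective₀ ht).injOn
  rw [resForm_eq, critSet_scale ht, finsum_mem_image hinj]
  · rw [finsum_mem_congr rfl fun q hq => critTerm_scale ht (critSet_subset_regSet x hq) v,
      critSet_eq_roots hr hx.1, finsum_mem_coe_finset]
  · rw [critSet_scale ht]
    rintro _ ⟨q, hq, rfl⟩
    rw [deriv_deriv_lam_scale ht]
    exact mul_ne_zero (mul_ne_zero (pow_ne_zero _ ht) (pow_ne_zero _ (inv_ne_zero ht))) (hx.2 q hq)

theorem hasDerivAt_critTerm_scale_inv {k : ℕ} (x : Coef ℓ r np) (v : Fin k → Coef ℓ r np) (q : ℂ) :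
    HasDerivAt (fun t => critTerm x (fun j => scale t⁻¹ (v j)) q)
      (-(((ℓ : ℂ) + 1) *
        ∑ j, critTerm x (Function.update v j (eulerField ℓ r np (v j))) q)) 1 := by
  have h1 : ∀ j, HasDerivAt (fun t => lieLam x (scale t⁻¹ (v j)) q)
      (-(((ℓ : ℂ) + 1) * lieLam x (eulerField ℓ r np (v j)) q)) 1 := fun j => by
    have := (fderiv ℂ (fun y : Coef ℓ r np => lam y q) x).hasFDerivAt.comp_hasDerivAt 1
      (hasDerivAt_scale_inv (v j))
    exact this.congr_deriv (by simp [lieLam])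
  have h2 := HasDerivAt.fun_finsetProd (u := Finset.univ) fun j _ => h1 j
  refine ((h2.mul_const (omegaDensity q ^ 2)).div_const (deriv (deriv (lam x)) q)).congr_deriv ?_
  rw [Finset.sum_mul, Finset.sum_div, Finset.mul_sum, ← Finset.sum_neg_distrib]
  refine Finset.sum_congr rfl fun j _ => ?_
  have h3 : ∀ i, lieLam x (Function.update v j (eulerField ℓ r np (v j)) i) q =
      Function.update (fun i => lieLam x (v i) q) j (lieLam x (eulerField ℓ r np (v j)) q) i :=
    fun i => Function.apply_update (fun _ u => lieLam x u q) v j _ i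
  simp only [critTerm, h3, Finset.prod_update_of_mem (Finset.mem_univ j), inv_one, scale_one,
    smul_eq_mul, Finset.sdiff_singleton_eq_erase]
  ring

/-- Near a semisimple point the form is a finite sum, over a fixed index set, of rational
expressions along holomorphic branches. The chain rule in `lie_resForm` requires this. -/
theorem differentiableAt_resForm (hr : 1 ≤ r) {k : ℕ} {x : Coef ℓ r np}
    (hx : x ∈ semisimpleLocus ℓ r np) (v : Fin k → Coef ℓ r np) :
    DifferentiableAt ℂ (fun y => resForm y v) x := by
  obtain ⟨q, hq, hev⟩ := exists_critBranches hr hx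
  set S := (critPoly x).roots.toFinset with hS
  have hω : (ω : WithTop ℕ∞) ≠ 0 := by simp
  have hpair : ∀ s ∈ S, DifferentiableAt ℂ (fun y => (y, q s y)) x := fun s hs =>
    differentiableAt_id.prodMk (hq s hs).2.1.differentiableAt
  have hR' : ∀ s ∈ S, DifferentiableAt ℂ (fun y => (derivative (critPoly y)).eval (q s y)) x :=
    fun s hs => ((contDiff_eval_derivative_critPoly.differentiable hω) (x, q s x)).comp
      (f := fun y => (y, q s y)) x (hpair s hs)
  have hP : ∀ s ∈ S, DifferentiableAt ℂ (fun y : Coef ℓ r np => (monicPoly y.1).eval (q s y)) x :=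
    fun s hs => ((contDiff_eval_fst 0).differentiable hω (x, q s x)).comp
      (f := fun y => (y, q s y)) x (hpair s hs)
  have hQ : ∀ s ∈ S, DifferentiableAt ℂ (fun y : Coef ℓ r np => (monicPoly y.2).eval (q s y)) x :=
    fun s hs => ((contDiff_eval_snd 0).differentiable hω (x, q s x)).comp
      (f := fun y => (y, q s y)) x (hpair s hs)
  have hpoly : ∀ s ∈ S, ∀ F : ℂ[X], DifferentiableAt ℂ (fun y => F.eval (q s y)) x :=
    fun s hs F => (F.differentiable (q s x)).comp x (hq s hs).2.1.differentiableAt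
  have hreg : ∀ s ∈ S, q s x ∈ regSet x := fun s hs =>
    critSet_subset_regSet x (hq s hs).2.2.self_of_nhds
  have hne : ∀ s ∈ S, (derivative (critPoly x)).eval (q s x) ≠ 0 := fun s hs =>
    eval_derivative_critPoly_ne_zero hr hx (mem_critSet_iff.1 (hq s hs).2.2.self_of_nhds).2
  have hneev : ∀ᶠ y in 𝓝 x, ∀ s ∈ S, (derivative (critPoly y)).eval (q s y) ≠ 0 :=
    (eventually_all_finset _).2 fun s hs => (hR' s hs).continuousAt.eventually_ne (hne s hs)
  have hform : (fun y => resForm y v) =ᶠ[𝓝 x] fun y => ∑ s ∈ S,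
      (∏ j, ((lowPoly (v j).1).eval (q s y) * (monicPoly y.2).eval (q s y) -
          (monicPoly y.1).eval (q s y) * (lowPoly (v j).2).eval (q s y))) *
        (∏ _j : Fin k, (q s y ^ r * (monicPoly y.2).eval (q s y) ^ 2)⁻¹) *
        ((q s y)⁻¹) ^ 2 * ((derivative (critPoly y)).eval (q s y))⁻¹ *
          (q s y ^ (r + 1) * (monicPoly y.2).eval (q s y) ^ 2) := by
    filter_upwards [hev, hneev] with y hy hy'
    have hmem : ∀ s ∈ S, q s y ∈ critSet y := fun s hs => by
      rw [hy.2]; exact Set.mem_image_of_mem _ hs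
    rw [resForm_eq, hy.2, finsum_mem_image hy.1, finsum_mem_coe_finset]
    · refine Finset.sum_congr rfl fun s hs => ?_
      rw [critTerm, deriv_deriv_lam (hmem s hs), ← Finset.prod_mul_distrib]
      simp only [lieLam_eq (critSet_subset_regSet y (hmem s hs)), omegaDensity, eval_sub, eval_mul,
        div_eq_mul_inv, mul_inv, inv_inv]
      ring
    · rw [hy.2]
      rintro _ ⟨s, hs, rfl⟩
      rw [deriv_deriv_lam (hmem s hs)]
      have := critSet_subset_regSet y (hmem s hs)
      exact div_ne_zero (hy' s hs)
        (mul_ne_zero (pow_ne_zero _ this.1) (pow_ne_zero _ this.2))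
  refine DifferentiableAt.congr_of_eventuallyEq ?_ hform
  refine DifferentiableAt.fun_sum fun s hs => ?_
  have d1 := (hq s hs).2.1.differentiableAt
  have d2 := hP s hs
  have d3 := hQ s hs
  have d4 := hR' s hs
  have n1 := (hreg s hs).1
  have n2 : q s x ^ r * (monicPoly x.2).eval (q s x) ^ 2 ≠ 0 :=
    mul_ne_zero (pow_ne_zero _ (hreg s hs).1) (pow_ne_zero _ (hreg s hs).2)
  have n3 := hne s hs
  have hprod : ∀ g : Fin k → Coef ℓ r np → ℂ, (∀ j, DifferentiableAt ℂ (g j) x) →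
      DifferentiableAt ℂ (fun y => ∏ j, g j y) x := fun g hg =>
    (HasFDerivAt.finsetProd fun j _ => (hg j).hasFDerivAt).differentiableAt
  refine ((((hprod _ fun j => ?_).fun_mul (hprod _ fun j => ?_)).fun_mul ?_).fun_mul ?_).fun_mul ?_
  · exact ((hpoly s hs _).fun_mul d3).fun_sub (d2.fun_mul (hpoly s hs _))
  · exact ((d1.fun_pow r).fun_mul (d3.fun_pow 2)).fun_inv n2
  · exact (d1.fun_inv n1).fun_pow 2
  · exact d4.fun_inv n3
  · exact (d1.fun_pow _).fun_mul (d3.fun_pow 2)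

/-- The form at `scale t x` is differentiated at `t = 1` twice: by the chain rule, and by
homogeneity, where transporting the vectors by `t⁻¹` produces the sum with a minus sign. As `E` is
linear, `DE(v) = E(v)`, so the left side is the Lie derivative. -/
theorem lie_resForm (hr : 1 ≤ r) {k : ℕ} {x : Coef ℓ r np} (hx : x ∈ semisimpleLocus ℓ r np)
    (v : Fin (k + 1) → Coef ℓ r np) :
    fderiv ℂ (fun y => resForm y v) x (eulerField ℓ r np x) +
      ∑ j, resForm x (Function.update v j (eulerField ℓ r np (v j))) = k * resForm x v := by
  have hl : (ℓ : ℂ) + 1 ≠ 0 := Nat.cast_add_one_ne_zero ℓ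
  have hd : HasFDerivAt (fun y => resForm y v) (fderiv ℂ (fun y => resForm y v) x)
      (scale 1 x) := by
    rw [scale_one]
    exact (differentiableAt_resForm hr hx v).hasFDerivAt
  have h1 := hd.comp_hasDerivAt 1 (hasDerivAt_scale x)
  have hpow : HasDerivAt (fun t : ℂ => (t ^ (ℓ + 1)) ^ k) (k * ((ℓ : ℂ) + 1)) 1 := by
    simpa using (hasDerivAt_pow (ℓ + 1) (1 : ℂ)).fun_pow k
  have h2 : HasDerivAt (fun t => resForm (scale t x) v)
      (∑ q ∈ (critPoly x).roots.toFinset, ((k * ((ℓ : ℂ) + 1)) * critTerm x v q +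
        -(((ℓ : ℂ) + 1) *
          ∑ j, critTerm x (Function.update v j (eulerField ℓ r np (v j))) q))) 1 := by
    have h3 : HasDerivAt (fun t => ∑ q ∈ (critPoly x).roots.toFinset,
        (t ^ (ℓ + 1)) ^ k * critTerm x (fun j => scale t⁻¹ (v j)) q) _ 1 :=
      HasDerivAt.fun_sum fun q _ => hpow.fun_mul (hasDerivAt_critTerm_scale_inv x v q)
    refine (h3.congr_deriv ?_).congr_of_eventuallyEq ?_
    · simp
    · exact (eventually_ne_nhds one_ne_zero).mono fun t ht => resForm_scale hr hx ht v
  have h4 := h1.unique h2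
  rw [Finset.sum_add_distrib, ← Finset.mul_sum, Finset.sum_neg_distrib, ← Finset.mul_sum,
    Finset.sum_comm, map_smul, smul_eq_mul] at h4
  simp only [resForm_eq_sum hr hx]
  refine mul_left_cancel₀ hl ?_
  linear_combination h4

theorem isEulerField_eulerField (hr : 1 ≤ r) : IsEulerField ℓ r np (eulerField ℓ r np) where
  holomorphic x _ := (hasFDerivAt_eulerField x).differentiableAt.differentiableWithinAt
  canonical _ _ _ hq := eulerField_canonical hq
  homogeneous := by
    -- The weights `1` for `η` and `2` for `c` are `2 - d` and `3 - d` with `d = 1`.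
    refine ⟨1, fun x hx => ⟨fun v₁ v₂ => ?_, fun v₁ v₂ v₃ => ?_⟩⟩
    · have h := lie_resForm hr hx ![v₁, v₂]
      have u₀ : ∀ u, Function.update ![v₁, v₂] 0 u = ![u, v₂] := fun u =>
        funext fun i => by fin_cases i <;> rfl
      have u₁ : ∀ u, Function.update ![v₁, v₂] 1 u = ![v₁, u] := fun u =>
        funext fun i => by fin_cases i <;> rfl
      rw [Fin.sum_univ_two, u₀, u₁] at h
      simp only [lieEta, eta_eq_resForm, fderiv_eulerField]
      refine (add_assoc _ _ _).trans (h.trans ?_)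
      push_cast
      ring
    · have h := lie_resForm hr hx ![v₁, v₂, v₃]
      have u₀ : ∀ u, Function.update ![v₁, v₂, v₃] 0 u = ![u, v₂, v₃] := fun u =>
        funext fun i => by fin_cases i <;> rfl
      have u₁ : ∀ u, Function.update ![v₁, v₂, v₃] 1 u = ![v₁, u, v₃] := fun u =>
        funext fun i => by fin_cases i <;> rfl
      have u₂ : ∀ u, Function.update ![v₁, v₂, v₃] 2 u = ![v₁, v₂, u] := fun u =>
        funext fun i => by fin_cases i <;> rfl
      rw [Fin.sum_univ_three, u₀, u₁, u₂] at h
      simp only [lieThreePoint, threePoint_eq_resForm, fderiv_eulerField]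
      rw [add_assoc, add_assoc, ← add_assoc (resForm x _)]
      refine h.trans ?_
      push_cast
      ring

/-! ### Families of polynomials with differentiable coefficients -/

section CoeffDifferentiable

variable {V : Type*} [NormedAddCommGroup V] [NormedSpace ℂ V]

/-- All coefficients of the family of polynomials `f` are differentiable at `z`. -/
def CoeffDifferentiableAt (f : V → ℂ[X]) (z : V) : Prop :=
  ∀ n, DifferentiableAt ℂ (fun y => (f y).coeff n) z

theorem CoeffDifferentiableAt.const (P : ℂ[X]) (z : V) :
    CoeffDifferentiableAt (fun _ => P) z := fun _ => differentiableAt_const _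

theorem CoeffDifferentiableAt.C {f : V → ℂ} {z : V} (hf : DifferentiableAt ℂ f z) :
    CoeffDifferentiableAt (fun y => C (f y)) z := fun n => by
  by_cases hn : n = 0
  · simpa [hn] using hf
  · simp [coeff_C, hn]

theorem CoeffDifferentiableAt.add {f g : V → ℂ[X]} {z : V} (hf : CoeffDifferentiableAt f z)
    (hg : CoeffDifferentiableAt g z) : CoeffDifferentiableAt (fun y => f y + g y) z := fun n => by
  simpa using (hf n).fun_add (hg n)

theorem CoeffDifferentiableAt.sub {f g : V → ℂ[X]} {z : V} (hf : CoeffDifferentiableAt f z)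
    (hg : CoeffDifferentiableAt g z) : CoeffDifferentiableAt (fun y => f y - g y) z := fun n => by
  simpa using (hf n).fun_sub (hg n)

theorem CoeffDifferentiableAt.mul {f g : V → ℂ[X]} {z : V} (hf : CoeffDifferentiableAt f z)
    (hg : CoeffDifferentiableAt g z) : CoeffDifferentiableAt (fun y => f y * g y) z := fun n => by
  simp only [coeff_mul]
  exact DifferentiableAt.fun_sum fun i _ => (hf i.1).fun_mul (hg i.2)

theorem CoeffDifferentiableAt.sum {ι : Type*} (s : Finset ι) {f : ι → V → ℂ[X]} {z : V}
    (hf : ∀ i, CoeffDifferentiableAt (f i) z) :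
    CoeffDifferentiableAt (fun y => ∑ i ∈ s, f i y) z := fun n => by
  simp only [finsetSum_coeff]
  exact DifferentiableAt.fun_sum fun i _ => hf i n

theorem CoeffDifferentiableAt.prod {ι : Type*} (s : Finset ι) {f : ι → V → ℂ[X]} {z : V}
    (hf : ∀ i, CoeffDifferentiableAt (f i) z) :
    CoeffDifferentiableAt (fun y => ∏ i ∈ s, f i y) z := by
  classical
  induction s using Finset.induction_on with
  | empty => simpa using CoeffDifferentiableAt.const 1 z
  | insert a s ha ih => simpa [Finset.prod_insert ha] using (hf a).mul ih

theorem CoeffDifferentiableAt.lowCoeffs {f : V → ℂ[X]} {z : V} (hf : CoeffDifferentiableAt f z)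
    (n : ℕ) : DifferentiableAt ℂ (fun y => lowCoeffs n (f y)) z :=
  differentiableAt_pi.2 fun i => hf i

theorem CoeffDifferentiableAt.X_sub_C_exp {f : V → ℂ} {z : V} (hf : DifferentiableAt ℂ f z) :
    CoeffDifferentiableAt (fun y => X - Polynomial.C (Complex.exp (f y))) z :=
  (CoeffDifferentiableAt.const X z).sub (CoeffDifferentiableAt.C hf.cexp)

end CoeffDifferentiable

/-! ### Coefficients as functions of the logarithms of the roots -/

theorem monicPoly_injective {n : ℕ} : Function.Injective (monicPoly : (Fin n → ℂ) → ℂ[X]) :=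
  fun _ _ h => lowPoly_injective (add_left_cancel h)

/-- The coefficients of the monic polynomial with roots `exp z_j`. -/
def expCoeffs {n : ℕ} (z : Fin n → ℂ) : Fin n → ℂ := lowCoeffs n (expRootsPoly z)

theorem monicPoly_expCoeffs {n : ℕ} (z : Fin n → ℂ) : monicPoly (expCoeffs z) = expRootsPoly z :=
  monicPoly_lowCoeffs (expRootsPoly_monic z) (expRootsPoly_natDegree z)

theorem eval_expRootsPoly {n : ℕ} (z : Fin n → ℂ) (w : ℂ) :
    (expRootsPoly z).eval w = ∏ j, (w - Complex.exp (z j)) := by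
  simp [expRootsPoly, eval_prod]

theorem differentiableAt_expCoeffs {n : ℕ} (z : Fin n → ℂ) : DifferentiableAt ℂ expCoeffs z :=
  CoeffDifferentiableAt.lowCoeffs
    (CoeffDifferentiableAt.prod _ fun i => CoeffDifferentiableAt.X_sub_C_exp
      (differentiableAt_apply i z)) n

theorem prod_smul_sub {n : ℕ} (s : Finset (Fin n)) (z : Fin n → ℂ) (τ w : ℂ) :
    ∏ j ∈ s, (Complex.exp τ * w - Complex.exp (z j + τ)) =
      Complex.exp τ ^ s.card * ∏ j ∈ s, (w - Complex.exp (z j)) := by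
  rw [← Finset.prod_const, ← Finset.prod_mul_distrib]
  refine Finset.prod_congr rfl fun j _ => ?_
  rw [Complex.exp_add]; ring

/-- Comparing values identifies the scaled coefficients without expanding symmetric functions of the
roots. -/
theorem eq_wscale_of_eval {n : ℕ} {c d : Fin n → ℂ} {t : ℂ} (ht : t ≠ 0)
    (h : ∀ w, (monicPoly d).eval (t * w) = t ^ n * (monicPoly c).eval w) : d = wscale t c := by
  refine monicPoly_injective (Polynomial.funext fun u => ?_)
  rw [← mul_inv_cancel_left₀ ht u, h, eval_monicPoly_wscale]

theorem expCoeffs_add {n : ℕ} (z : Fin n → ℂ) (τ : ℂ) :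
    expCoeffs (fun j => z j + τ) = wscale (Complex.exp τ) (expCoeffs z) := by
  refine eq_wscale_of_eval (Complex.exp_ne_zero τ) fun w => ?_
  simp only [monicPoly_expCoeffs, eval_expRootsPoly, prod_smul_sub, Finset.card_univ,
    Fintype.card_fin]

theorem hasDerivAt_wscale_exp {n : ℕ} (c : Fin n → ℂ) :
    HasDerivAt (fun τ : ℂ => wscale (Complex.exp τ) c) (wgen c) 0 := by
  have h : HasDerivAt (fun t : ℂ => wscale t c) (wgen c) (Complex.exp 0) := by
    rw [Complex.exp_zero]; exact hasDerivAt_wscale c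
  exact (h.scomp 0 (Complex.hasDerivAt_exp 0)).congr_deriv (by simp)

/-- Shifting all logarithms by `τ` multiplies the roots by `exp τ`; differentiate at `τ = 0`. -/
theorem fderiv_expCoeffs_one {n : ℕ} (z : Fin n → ℂ) :
    fderiv ℂ expCoeffs z (fun _ => 1) = wgen (expCoeffs z) := by
  have h1 : HasDerivAt (fun τ : ℂ => fun j => z j + τ) (fun _ => (1 : ℂ)) 0 :=
    hasDerivAt_pi.2 fun j => (hasDerivAt_id (0 : ℂ)).const_add (z j)
  have hd : HasFDerivAt expCoeffs (fderiv ℂ expCoeffs z) (fun j => z j + (0 : ℂ)) := by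
    simpa using (differentiableAt_expCoeffs z).hasFDerivAt
  have h2 : HasDerivAt (fun τ : ℂ => expCoeffs fun j => z j + τ)
      (fderiv ℂ expCoeffs z fun _ => 1) 0 :=
    hd.comp_hasDerivAt (l := expCoeffs) (f := fun (τ : ℂ) j => z j + τ) 0 h1
  simp only [expCoeffs_add] at h2
  exact h2.unique (hasDerivAt_wscale_exp (expCoeffs z))

/-- Differentiate the product at the fixed point `w = exp z_k`: only the factor `j = k` contributes,
giving `-v_k exp z_k` times a product of nonzero differences of roots. -/
theorem eq_zero_of_fderiv_expCoeffs_eq_zero {n : ℕ} {z v : Fin n → ℂ}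
    (hz : Function.Injective fun j => Complex.exp (z j)) (hv : fderiv ℂ expCoeffs z v = 0) :
    v = 0 := by
  funext k
  set w := Complex.exp (z k) with hw
  have h1 : HasFDerivAt (fun y : Fin n → ℂ => (monicPoly (expCoeffs y)).eval w)
      ((evalLow n w).comp (fderiv ℂ expCoeffs z)) z :=
    (hasFDerivAt_eval_monicPoly w (expCoeffs z)).comp z
      (differentiableAt_expCoeffs z).hasFDerivAt
  have h2 : HasFDerivAt (fun y : Fin n → ℂ => ∏ j, (w - Complex.exp (y j)))
      (∑ j, (∏ i ∈ Finset.univ.erase j, (w - Complex.exp (z i))) •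
        -(Complex.exp (z j) • (ContinuousLinearMap.proj j : (Fin n → ℂ) →L[ℂ] ℂ))) z :=
    HasFDerivAt.finsetProd fun j _ => ((hasFDerivAt_apply j z).cexp).const_sub w
  simp only [monicPoly_expCoeffs, eval_expRootsPoly] at h1
  have h3 := congrArg (fun L => L v) (h1.unique h2)
  simp only [ContinuousLinearMap.comp_apply, hv, map_zero, sum_apply] at h3
  rw [Finset.sum_eq_single k] at h3
  · have hne : ∏ i ∈ Finset.univ.erase k, (w - Complex.exp (z i)) ≠ 0 :=
      Finset.prod_ne_zero_iff.2 fun i hi => sub_ne_zero.2 fun h => (Finset.mem_erase.1 hi).1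
        (hz h).symm
    rw [hw] at hne
    simpa [hne, hw] using h3
  · intro j _ hj
    have : ∏ i ∈ Finset.univ.erase j, (w - Complex.exp (z i)) = 0 :=
      Finset.prod_eq_zero (Finset.mem_erase.2 ⟨hj.symm, Finset.mem_univ k⟩) (sub_self _)
    simp [this]
  · simp

theorem injective_exp_of_mem {x : Coef ℓ r np} (hx : x ∈ hurwitzSpace ℓ r np) {z : Fin np → ℂ}
    (h : x.2 = expCoeffs z) : Function.Injective fun j => Complex.exp (z j) := by
  have hsep := hx.1
  rw [h, monicPoly_expCoeffs] at hsep
  exact separable_prod_X_sub_C_iff.1 hsep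

/-! ### The coordinates `(φ, ψ)` -/

theorem hasFDerivAt_phiPsiChart (z : (Fin (ℓ + r + np + 1) → ℂ) × (Fin np → ℂ)) :
    HasFDerivAt (phiPsiChart ℓ r np)
      ((fderiv ℂ expCoeffs z.1).prodMap (fderiv ℂ expCoeffs z.2)) z :=
  (differentiableAt_expCoeffs z.1).hasFDerivAt.prodMap z (differentiableAt_expCoeffs z.2).hasFDerivAt

theorem fderiv_phiPsiChart_eq_iff {z : (Fin (ℓ + r + np + 1) → ℂ) × (Fin np → ℂ)}
    (hz : z ∈ phiPsiDomain ℓ r np) (v : (Fin (ℓ + r + np + 1) → ℂ) × (Fin np → ℂ)) :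
    fderiv ℂ (phiPsiChart ℓ r np) z v = eulerField ℓ r np (phiPsiChart ℓ r np z) ↔
      v = (fun _ => 1 / ((ℓ : ℂ) + 1), fun _ => 1 / ((ℓ : ℂ) + 1)) := by
  have hker : ∀ v, fderiv ℂ (phiPsiChart ℓ r np) z v = 0 → v = 0 := fun v hv => by
    rw [(hasFDerivAt_phiPsiChart z).fderiv] at hv
    exact Prod.ext (eq_zero_of_fderiv_expCoeffs_eq_zero hz.2 (congrArg Prod.fst hv))
      (eq_zero_of_fderiv_expCoeffs_eq_zero (injective_exp_of_mem hz.1 rfl) (congrArg Prod.snd hv))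
  have hconst : ∀ n : ℕ, (fun _ : Fin n => 1 / ((ℓ : ℂ) + 1)) =
      (1 / ((ℓ : ℂ) + 1)) • fun _ => (1 : ℂ) := fun n => by ext; simp
  have hval : fderiv ℂ (phiPsiChart ℓ r np) z
      (fun _ => 1 / ((ℓ : ℂ) + 1), fun _ => 1 / ((ℓ : ℂ) + 1)) =
      eulerField ℓ r np (phiPsiChart ℓ r np z) := by
    rw [(hasFDerivAt_phiPsiChart z).fderiv, eulerField_apply, hconst, hconst]
    rw [ContinuousLinearMap.coe_prodMap', Prod.map_apply, map_smul, map_smul,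
      fderiv_expCoeffs_one, fderiv_expCoeffs_one]
    rfl
  refine ⟨fun h => sub_eq_zero.1 (hker _ ?_), fun h => h ▸ hval⟩
  rw [map_sub, h, hval, sub_self]

/-! ### The coordinates `(σ, α, β)` -/

theorem differentiableAt_flatChart (s : Flat ℓ r np) :
    DifferentiableAt ℂ (flatChart ℓ r np) s := by
  have hβ : ∀ μ, DifferentiableAt ℂ (fun s : Flat ℓ r np => s.2.2 μ) s := fun μ => by fun_prop
  have hQ : CoeffDifferentiableAt (fun s : Flat ℓ r np => expRootsPoly s.2.2) s :=
    CoeffDifferentiableAt.prod _ fun μ => CoeffDifferentiableAt.X_sub_C_exp (hβ μ)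
  refine DifferentiableAt.prodMk (CoeffDifferentiableAt.lowCoeffs ?_ _) (hQ.lowCoeffs _)
  refine CoeffDifferentiableAt.add (CoeffDifferentiableAt.mul ?_ hQ)
    (CoeffDifferentiableAt.sum _ fun μ => CoeffDifferentiableAt.mul (CoeffDifferentiableAt.mul
      (CoeffDifferentiableAt.C (by fun_prop)) (CoeffDifferentiableAt.const _ _))
      (CoeffDifferentiableAt.prod _ fun ν => CoeffDifferentiableAt.X_sub_C_exp (hβ ν)))
  exact CoeffDifferentiableAt.add (CoeffDifferentiableAt.const _ _)
    (CoeffDifferentiableAt.sum _ fun p => CoeffDifferentiableAt.mul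
      (CoeffDifferentiableAt.C (by fun_prop)) (CoeffDifferentiableAt.const _ _))

theorem monicPoly_flatChart (s : Flat ℓ r np) : monicPoly (flatChart ℓ r np s).1 = flatNum s :=
  monicPoly_lowCoeffs (flatNum_monic s).1 (flatNum_monic s).2

theorem eval_flatNum (s : Flat ℓ r np) (w : ℂ) :
    (flatNum s).eval w = (monicPoly s.1).eval w * ∏ μ, (w - Complex.exp (s.2.2 μ)) +
      ∑ μ, s.2.1 μ * w ^ (r + 1) *
        ∏ ν ∈ Finset.univ.erase μ, (w - Complex.exp (s.2.2 ν)) := by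
  simp [flatNum, eval_expRootsPoly, eval_finsetSum, eval_prod]

/-- The scaling of the superpotential in the coordinates `(σ, α, β)`. -/
def flatScale (s : Flat ℓ r np) (τ : ℂ) : Flat ℓ r np :=
  (wscale (Complex.exp τ) s.1, fun μ => Complex.exp τ ^ (ℓ + 1) * s.2.1 μ, fun μ => s.2.2 μ + τ)

/-- Under the dilation `σ_p` has weight `ℓ + 1 + r - p`, `α_μ` has weight `ℓ + 1`, and `exp β_μ` has
weight `1`. -/
theorem flatChart_flatScale (s : Flat ℓ r np) (τ : ℂ) :
    flatChart ℓ r np (flatScale s τ) = scale (Complex.exp τ) (flatChart ℓ r np s) := by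
  refine Prod.ext (eq_wscale_of_eval (Complex.exp_ne_zero τ) fun w => ?_) (expCoeffs_add s.2.2 τ)
  rw [monicPoly_flatChart, monicPoly_flatChart, eval_flatNum, eval_flatNum]
  simp only [flatScale, eval_monicPoly_wscale, prod_smul_sub, Finset.card_univ, Fintype.card_fin]
  rw [mul_add, Finset.mul_sum]
  congr 1
  · ring
  · refine Finset.sum_congr rfl fun μ _ => ?_
    rw [Finset.card_erase_of_mem (Finset.mem_univ μ), Finset.card_univ, Fintype.card_fin]
    have hμ := μ.2
    -- The index `μ` ensures `np ≥ 1`, so `np - 1` is a true difference.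
    have hpow : Complex.exp τ ^ (ℓ + r + np + 1) =
        Complex.exp τ ^ (ℓ + 1) * Complex.exp τ ^ (r + 1) * Complex.exp τ ^ (np - 1) := by
      rw [← pow_add, ← pow_add]
      congr 1
      omega
    rw [hpow, mul_pow]
    ring

theorem hasDerivAt_flatScale (s : Flat ℓ r np) :
    HasDerivAt (flatScale s) (wgen s.1, fun μ => ((ℓ : ℂ) + 1) * s.2.1 μ, fun _ => 1) 0 := by
  refine (hasDerivAt_wscale_exp s.1).prodMk (HasDerivAt.prodMk (hasDerivAt_pi.2 fun μ => ?_)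
    (hasDerivAt_pi.2 fun μ => (hasDerivAt_id (0 : ℂ)).const_add (s.2.2 μ)))
  simpa using ((Complex.hasDerivAt_exp 0).fun_pow (ℓ + 1)).mul_const (s.2.1 μ)

theorem fderiv_flatChart_flatScale (s : Flat ℓ r np) :
    fderiv ℂ (flatChart ℓ r np) s (wgen s.1, fun μ => ((ℓ : ℂ) + 1) * s.2.1 μ, fun _ => 1) =
      ((ℓ : ℂ) + 1) • eulerField ℓ r np (flatChart ℓ r np s) := by
  have h0 : flatScale s 0 = s := by
    ext i <;> simp [flatScale, wscale]
  have hd : HasFDerivAt (flatChart ℓ r np) (fderiv ℂ (flatChart ℓ r np) s) (flatScale s 0) := by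
    rw [h0]; exact (differentiableAt_flatChart s).hasFDerivAt
  have h1 : HasDerivAt (fun t => scale t (flatChart ℓ r np s))
      (((ℓ : ℂ) + 1) • eulerField ℓ r np (flatChart ℓ r np s)) (Complex.exp 0) := by
    rw [Complex.exp_zero]; exact hasDerivAt_scale _
  have h2 := h1.scomp 0 (Complex.hasDerivAt_exp 0)
  rw [Complex.exp_zero, one_smul] at h2
  exact (hd.comp_hasDerivAt 0 (hasDerivAt_flatScale s)).unique
    (h2.congr_of_eventuallyEq (Eventually.of_forall fun τ => flatChart_flatScale s τ))

/-- With the poles fixed the numerator is affine in `(σ, α)`, so its variation is exact to first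
order. -/
theorem flatNum_add_smul (s v : Flat ℓ r np) (hv : v.2.2 = 0) (τ : ℂ) :
    flatNum (s + τ • v) = flatNum s + C τ * (lowPoly v.1 * expRootsPoly s.2.2 +
      ∑ μ, C (v.2.1 μ) * X ^ (r + 1) *
        ∏ ν ∈ Finset.univ.erase μ, (X - C (Complex.exp (s.2.2 ν)))) := by
  have hlow : lowPoly (s.1 + τ • v.1) = lowPoly s.1 + C τ * lowPoly v.1 := by
    simp [lowPoly, add_mul, Finset.sum_add_distrib, Finset.mul_sum, mul_assoc]
  simp only [flatNum, Prod.fst_add, Prod.snd_add, Prod.smul_fst, Prod.smul_snd, hv, smul_zero,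
    add_zero, Pi.zero_apply, monicPoly_eq, hlow, Pi.add_apply, Pi.smul_apply, smul_eq_mul, C_add, C_mul, add_mul,
    Finset.sum_add_distrib, mul_add, Finset.mul_sum]
  simp only [mul_assoc]
  ring

/-- The differential is triangular: the denominator gives the `β` part, the values of the
numerator's variation at the poles give the `α` part, and what remains is the `σ` part times a monic
polynomial. -/
theorem eq_zero_of_fderiv_flatChart_eq_zero {s : Flat ℓ r np} (hs : s ∈ flatDomain ℓ r np)
    {v : Flat ℓ r np} (hv : fderiv ℂ (flatChart ℓ r np) s v = 0) : v = 0 := by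
  have hinj := injective_exp_of_mem (z := s.2.2) hs rfl
  have hd := (differentiableAt_flatChart s).hasFDerivAt
  have hβ : v.2.2 = 0 := by
    refine eq_zero_of_fderiv_expCoeffs_eq_zero hinj ?_
    have h1 : HasFDerivAt (fun s : Flat ℓ r np => (flatChart ℓ r np s).2) _ s := hd.snd
    have hsnd := ((ContinuousLinearMap.snd ℂ (Fin np → ℂ) (Fin np → ℂ)).comp
      (ContinuousLinearMap.snd ℂ (Fin (ℓ + r + 1) → ℂ)
        ((Fin np → ℂ) × (Fin np → ℂ)))).hasFDerivAt (x := s)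
    have h2 : HasFDerivAt (fun s : Flat ℓ r np => expCoeffs s.2.2) _ s :=
      (differentiableAt_expCoeffs s.2.2).hasFDerivAt.comp (g := expCoeffs) s hsnd
    have h3 := congrArg (fun L => L v) (h1.unique h2)
    simpa [hv] using h3.symm
  set G := lowPoly v.1 * expRootsPoly s.2.2 + ∑ μ, C (v.2.1 μ) * X ^ (r + 1) *
    ∏ ν ∈ Finset.univ.erase μ, (X - C (Complex.exp (s.2.2 ν))) with hG
  have hline : ∀ τ : ℂ, (flatChart ℓ r np (s + τ • v)).1 =
      (flatChart ℓ r np s).1 + τ • lowCoeffs _ G := fun τ => by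
    ext i
    simp only [flatChart, flatNum_add_smul s v hβ, ← hG, lowCoeffs, coeff_add, coeff_C_mul,
      Pi.add_apply, Pi.smul_apply, smul_eq_mul]
  have hcoef : lowCoeffs (ℓ + r + np + 1) G = 0 := by
    have h1 : HasDerivAt (fun τ : ℂ => s + τ • v) v 0 := by
      simpa using ((hasDerivAt_id (0 : ℂ)).smul_const v).const_add s
    have hd' : HasFDerivAt (flatChart ℓ r np) (fderiv ℂ (flatChart ℓ r np) s)
        (s + (0 : ℂ) • v) := by simpa using hd
    have h2 := (hd'.comp_hasDerivAt 0 h1)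
    rw [hv] at h2
    have h3 : HasDerivAt (fun τ : ℂ => (flatChart ℓ r np (s + τ • v)).1) 0 0 :=
      (ContinuousLinearMap.fst ℂ (Fin (ℓ + r + np + 1) → ℂ) (Fin np → ℂ)).hasFDerivAt.comp_hasDerivAt
        0 h2
    simp only [hline] at h3
    have h4 := ((hasDerivAt_id (0 : ℂ)).smul_const
      (lowCoeffs (ℓ + r + np + 1) G)).const_add (flatChart ℓ r np s).1
    simpa using h4.unique h3
  -- No degree bound on `G` is needed: at `τ = 1` both numerators are monic with the same low
  -- coefficients, and they differ by `G`.
  have hG0 : G = 0 := by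
    have h1 := flatNum_add_smul s v hβ 1
    rw [← hG, ← monicPoly_flatChart, ← monicPoly_flatChart, hline, hcoef, smul_zero, add_zero,
      C_1, one_mul] at h1
    exact left_eq_add.1 h1
  -- At `exp β_μ` the `σ` term and all summands but the one of index `μ` vanish.
  have hα : v.2.1 = 0 := by
    funext μ
    have h1 := congrArg (eval (Complex.exp (s.2.2 μ))) hG0
    rw [hG, eval_add, eval_mul, eval_expRootsPoly,
      Finset.prod_eq_zero (Finset.mem_univ μ) (sub_self _), mul_zero, zero_add, eval_finsetSum,
      Finset.sum_eq_single μ, eval_mul, eval_prod] at h1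
    · simp only [eval_mul, eval_C, eval_pow, eval_X, eval_sub, eval_zero] at h1
      have hne : ∏ ν ∈ Finset.univ.erase μ,
          (Complex.exp (s.2.2 μ) - Complex.exp (s.2.2 ν)) ≠ 0 :=
        Finset.prod_ne_zero_iff.2 fun ν hν => sub_ne_zero.2 fun h =>
          (Finset.mem_erase.1 hν).1 (hinj h).symm
      simpa [hne] using h1
    · intro ν _ hν
      rw [eval_mul, eval_prod, Finset.prod_eq_zero (Finset.mem_erase.2 ⟨hν.symm, Finset.mem_univ μ⟩)
        (by simp), mul_zero]
    · simp
  have hσ : v.1 = 0 := by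
    have h1 : lowPoly v.1 * expRootsPoly s.2.2 = 0 := by simpa [hα] using hG.symm.trans hG0
    exact lowPoly_injective (((mul_eq_zero.1 h1).resolve_right
      (expRootsPoly_monic _).ne_zero).trans lowPoly_zero.symm)
  exact Prod.ext hσ (Prod.ext hα hβ)

theorem fderiv_flatChart_eq_iff {s : Flat ℓ r np} (hs : s ∈ flatDomain ℓ r np)
    (v : Flat ℓ r np) :
    fderiv ℂ (flatChart ℓ r np) s v = eulerField ℓ r np (flatChart ℓ r np s) ↔
      v = (fun p : Fin (ℓ + r + 1) => (1 + ((r : ℂ) - ((p : ℕ) : ℂ)) / ((ℓ : ℂ) + 1)) * s.1 p,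
        fun μ => s.2.1 μ, fun _ => 1 / ((ℓ : ℂ) + 1)) := by
  have hl : (ℓ : ℂ) + 1 ≠ 0 := Nat.cast_add_one_ne_zero ℓ
  have heq : (fun p : Fin (ℓ + r + 1) => (1 + ((r : ℂ) - ((p : ℕ) : ℂ)) / ((ℓ : ℂ) + 1)) * s.1 p,
      fun μ => s.2.1 μ, fun _ => 1 / ((ℓ : ℂ) + 1)) = (((ℓ : ℂ) + 1)⁻¹ •
        ((wgen s.1, fun μ => ((ℓ : ℂ) + 1) * s.2.1 μ, fun _ => 1) : Flat ℓ r np)) := by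
    refine Prod.ext (funext fun p => ?_) (Prod.ext (funext fun μ => ?_) (funext fun μ => ?_))
    · simp only [Prod.smul_fst, Pi.smul_apply, smul_eq_mul, wgen]
      push_cast
      field_simp
      ring
    · simp [hl]
    · simp
  have hval := congrArg (fun u => ((ℓ : ℂ) + 1)⁻¹ • u) (fderiv_flatChart_flatScale s)
  simp only [smul_smul, inv_mul_cancel₀ hl, one_smul, ← map_smul] at hval
  rw [heq]
  refine ⟨fun h => sub_eq_zero.1 (eq_zero_of_fderiv_flatChart_eq_zero hs ?_), fun h => h ▸ hval⟩
  rw [map_sub, h, hval, sub_self]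

end HurwitzEuler

end

/-- The `(a, b)` formula prescribes `E` at every point of the Hurwitz space, so it also contains
uniqueness. In the other charts the equivalence says that the components of `E` exist and are
unique. -/
theorem mainTheorem4 (ℓ r np : ℕ) (hr : 1 ≤ r) :
    (∃ E : HurwitzEuler.Coef ℓ r np → HurwitzEuler.Coef ℓ r np, HurwitzEuler.IsEulerField ℓ r np E) ∧
    ∀ E : HurwitzEuler.Coef ℓ r np → HurwitzEuler.Coef ℓ r np, HurwitzEuler.IsEulerField ℓ r np E →
      -- the coordinates `(φ, ψ)`
      (∀ z ∈ HurwitzEuler.phiPsiDomain ℓ r np,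
        DifferentiableAt ℂ (HurwitzEuler.phiPsiChart ℓ r np) z ∧
        ∀ v : (Fin (ℓ + r + np + 1) → ℂ) × (Fin np → ℂ),
          fderiv ℂ (HurwitzEuler.phiPsiChart ℓ r np) z v = E (HurwitzEuler.phiPsiChart ℓ r np z) ↔
            v = (fun _ => 1 / ((ℓ : ℂ) + 1), fun _ => 1 / ((ℓ : ℂ) + 1))) ∧
      -- the coordinates `(a, b)`
      (∀ x ∈ HurwitzEuler.hurwitzSpace ℓ r np,
        E x = (fun i : Fin (ℓ + r + np + 1) => 1 / ((ℓ : ℂ) + 1) * (((ℓ + r + np + 1 : ℕ) : ℂ) - ((i : ℕ) : ℂ)) * x.1 i,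
          fun j : Fin np => 1 / ((ℓ : ℂ) + 1) * ((np : ℂ) - ((j : ℕ) : ℂ)) * x.2 j)) ∧
      -- the coordinates `(σ, α, β)`
      (∀ s ∈ HurwitzEuler.flatDomain ℓ r np,
        DifferentiableAt ℂ (HurwitzEuler.flatChart ℓ r np) s ∧
        ∀ v : HurwitzEuler.Flat ℓ r np,
          fderiv ℂ (HurwitzEuler.flatChart ℓ r np) s v = E (HurwitzEuler.flatChart ℓ r np s) ↔
            v = (fun p : Fin (ℓ + r + 1) => (1 + ((r : ℂ) - ((p : ℕ) : ℂ)) / ((ℓ : ℂ) + 1)) * s.1 p,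
              fun μ => s.2.1 μ, fun _ => 1 / ((ℓ : ℂ) + 1))) := by
  refine ⟨⟨_, HurwitzEuler.isEulerField_eulerField hr⟩, fun E hE => ⟨fun z hz => ?_, fun x hx => ?_,
    fun s hs => ?_⟩⟩
  · rw [HurwitzEuler.eq_eulerField hr hE hz.1]
    exact ⟨(HurwitzEuler.hasFDerivAt_phiPsiChart z).differentiableAt,
      HurwitzEuler.fderiv_phiPsiChart_eq_iff hz⟩
  · rw [HurwitzEuler.eq_eulerField hr hE hx, HurwitzEuler.eulerField_apply]
    exact Prod.ext (funext fun i => (mul_assoc _ _ _).symm)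
      (funext fun j => (mul_assoc _ _ _).symm)
  · rw [HurwitzEuler.eq_eulerField hr hE hs]
    exact ⟨HurwitzEuler.differentiableAt_flatChart s, HurwitzEuler.fderiv_flatChart_eq_iff hs⟩
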